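/- **Setting.** Let $\mathcal X,\mathcal Z,\hat{\mathcal X}$ be finite alphabets, let $\Pi=\{\Pi(x,z)\}$ be a channel matrix (nonnegative entries, rows summing to $1$) of full row rank, and let $\Lambda:\mathcal X\times\hat{\mathcal X}\to[0,\infty)$ be a loss function. An $n$-block denoiser is a family $\hat{\mathbf X}^n=(\hat X_t)_{1\le t\le n}$ of maps $\hat X_t:\mathcal Z^n\to\hat{\mathcal X}$; its normalized loss is $L_{\hat{\mathbf X}^n}(x^n,z^n)=\frac1n\sum_{t=1}^n\Lambda(x_t,\hat X_t(z^n))$. For a distribution $P_{X^n}$ on $\mathcal X^n$, let $Z^n$ be the output of the memoryless channel $\Pi$ with input $X^n\sim P_{X^n}$, and let $\mathbb D(P_{X^n},\Pi)=\min_{\hat{\mathbf X}^n}E\,L_{\hat{\mathbf X}^n}(X^n,Z^n)$, the minimum being over all $n$-block denoisers. **The S-DUDE.** Let $\mathcal S$ be the set of all maps $s:\mathcal Z\to\hat{\mathcal X}$ and $N=|\mathcal S|=|\hat{\mathcal X}|^{|\mathcal Z|}$. Fix any matrix $H=\{H(z,x)\}$ with $\Pi H=I$, and put $\rho_x(s)=\sum_z\Lambda(x,s(z))\Pi(x,z)$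 and $\ell(z,s)=\sum_x H(z,x)\rho_x(s)$. For $k\ge 0$, $n>2k$, $z^n\in\mathcal Z^n$ and $k<t\le n-k$, the context of $t$ is $\mathbf c_t=(z_{t-k}^{t-1},z_{t+1}^{t+k})$, and $\mathcal T(\mathbf c)=\{t:k<t\le n-k,\ \mathbf c_t=\mathbf c\}$. For $0\le m\le\lfloor (n-2k)/2\rfloor$ let $\mathcal S^n_{k,m}(z^n)$ be the set of tuples $(s_t)_{k<t\le n-k}\in\mathcal S^{n-2k}$ such that, for every $\mathbf c\in\mathcal Z^{2k}$, the subsequence $(s_t)_{t\in\mathcal T(\mathbf c)}$ changes value between consecutive terms at most $\min\{|\mathcal T(\mathbf c)|,m\}$ times. Let $\hat{\mathbf S}(z^n)=(\hat s_t)$ be a minimizer of $\frac1{n-2k}\sum_{t=k+1}^{n-k}\ell(z_t,s_t)$ over $\mathcal S^n_{k,m}(z^n)$ (ties resolved in any way). The $(k,m)$-S-DUDE $\hat{\mathbf X}^{n,k,m}_{\rm univ}$ outputs $\hat s_t(z_t)$ at times $k<t\le n-k$ and an arbitrary fixed symbol of $\hat{\mathcal X}$ at the other times. **Piecewise stationary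 processes.** $\mathcal P\{m_n\}$ is the class of laws $P_{\mathbf X}$ of $\mathcal X$-valued processes $\mathbf X=(X_1,X_2,\dots)$ for which there are $M\in\mathbb N$, laws $P^{(1)},\dots,P^{(M)}$ of stationary $\mathcal X$-valued processes and a $\{1,\dots,M\}$-valued process $\mathbf A$ such that, for every $n$, the number $r(A^n)$ of $1\le j<n$ with $A_j\ne A_{j+1}$ is at most $m_n$ almost surely, and $$P_{X^n}(x^n)=\sum_{a^n}P_{A^n}(a^n)\prod_{i=1}^{r(a^n)+1}P^{(a_{\tau_i})}\big(x_{\tau_{i-1}+1}^{\tau_i}\big),$$ where $\tau_i$ is the last time of the $i$-th maximal constant block of $a^n$ and $\tau_0=0$. **Theorem.** For a finite array let the subscript "max" denote the difference between its largest and its smallest entry, let $L_{\max}=\Lambda_{\max}+\ell_{\max}$ and $h(p)=-p\ln p-(1-p)\ln(1-p)$. Let $(k_n)$, $(m_n)$ be sequences of nonnegative integers with $2k_n<n$ and $m_n\le\lfloor (n-2k_n)/2\rfloor$ for all large $n$, such that, with $k=k_n$ and $m=m_n$, for every $\epsilon>0$ the quantity $$2(k+1)\exp\Big(-(n-2k)\Big[\frac{\epsilon^2}{2(k+1)L_{\max}^2}-2|\mathcal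 Z|^{2k}\Big\{h\Big(\frac m{n-2k}\Big)+\frac{(m+1)\ln N}{n-2k}\Big\}\Big]\Big)$$ (read as $0$ if $L_{\max}=0$) is summable in $n$, and such that $k_n\to\infty$. Then for every $P_{\mathbf X}\in\mathcal P\{m_n\}$, $$\lim_{n\to\infty}\Big[E\,L_{\hat{\mathbf X}^{n,k_n,m_n}_{\rm univ}}(X^n,Z^n)-\mathbb D(P_{X^n},\Pi)\Big]=0 .$$ -/

import Mathlib

open Filter Topology MeasureTheory

namespace SDude

noncomputable section

/-! ### Denoisers, losses and the memoryless channel (times are indexed from `0`) -/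

section Losses

variable {X Z Y : Type*}

/-- An `n`-block denoiser: maps the noisy `n`-tuple to a reconstruction at every time. -/
abbrev BlockDenoiser (Z Y : Type*) (n : ℕ) := (Fin n → Z) → Fin n → Y

/-- Normalized cumulative loss of a denoiser on the pair `(x^n, z^n)`. -/
def loss (Λ : X → Y → ℝ) {n : ℕ} (D : BlockDenoiser Z Y n) (x : Fin n → X) (z : Fin n → Z) : ℝ :=
  (1 / (n : ℝ)) * ∑ t, Λ (x t) (D z t)

/-- The `n`-th order marginal of a process law. -/
def marginal [MeasurableSpace X] (PX : Measure (ℕ → X)) (n : ℕ) (x : Fin n → X) : ℝ :=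
  PX.real {ω | ∀ t : Fin n, ω t = x t}

/-- Expected normalized loss, when `X^n` has mass function `p` and `Z^n` is the output of the
memoryless channel `W` with input `X^n`. -/
def expectedLoss [Fintype X] [Fintype Z] (W : Matrix X Z ℝ) (Λ : X → Y → ℝ) {n : ℕ}
    (p : (Fin n → X) → ℝ) (D : BlockDenoiser Z Y n) : ℝ :=
  ∑ x : Fin n → X, p x * ∑ z : Fin n → Z, (∏ t, W (x t) (z t)) * loss Λ D x z

/-- The optimal distribution-dependent loss: the minimum of the expected loss over all (finitely
many) `n`-block denoisers. -/
def optimalLoss [Fintype X] [Fintype Z] (W : Matrix X Z ℝ) (Λ : X → Y → ℝ) {n : ℕ}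
    (p : (Fin n → X) → ℝ) : ℝ :=
  ⨅ D : BlockDenoiser Z Y n, expectedLoss W Λ p D

/-- `ρ_x(s)`: expected loss of the single-symbol denoiser `s` when the clean symbol is `x`. -/
def rho [Fintype Z] (W : Matrix X Z ℝ) (Λ : X → Y → ℝ) (s : Z → Y) (x : X) : ℝ :=
  ∑ z, Λ x (s z) * W x z

/-- The estimated loss `ℓ(z, s) = h(z)ᵀ ρ(s)`, where `h(z)` is the `z`-th row of `H`. -/
def estLoss [Fintype X] [Fintype Z] (W : Matrix X Z ℝ) (H : Matrix Z X ℝ) (Λ : X → Y → ℝ)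
    (z : Z) (s : Z → Y) : ℝ :=
  ∑ x, H z x * rho W Λ s x

end Losses

/-! ### The shifting denoiser -/

section Shifting

variable {X Z Y : Type*}

/-- The times with a complete two-sided context of order `k`
(`k + 1, …, n - k` when times are counted from `1`). -/
abbrev Window (n k : ℕ) := {t : Fin n // k ≤ (t : ℕ) ∧ (t : ℕ) + k < n}

/-- The two-sided context `(z_{t-k}^{t-1}, z_{t+1}^{t+k})`. -/
def context {n k : ℕ} (z : Fin n → Z) (t : Window n k) : (Fin k → Z) × (Fin k → Z) :=
  (fun i => z ⟨(t.1 : ℕ) - k + i, by have := t.2; have := i.2; omega⟩,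
   fun i => z ⟨(t.1 : ℕ) + 1 + i, by have := t.2; have := i.2; omega⟩)

open Classical in
/-- `𝒯(c)`: the times of the window whose context is `c`. -/
def contextTimes {n k : ℕ} (z : Fin n → Z) (c : (Fin k → Z) × (Fin k → Z)) :
    Finset (Window n k) :=
  Finset.univ.filter fun t => context z t = c

open Classical in
/-- Number of shifts of the tuple `S` along the increasing enumeration of `T`: the number of
pairs of consecutive elements of `T` at which `S` takes different values. -/
def numShifts {ι α : Type*} [LinearOrder ι] (T : Finset ι) (S : ι → α) : ℕ :=
  ((T ×ˢ T).filter fun p =>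
    p.1 < p.2 ∧ (∀ u ∈ T, ¬ (p.1 < u ∧ u < p.2)) ∧ S p.1 ≠ S p.2).card

/-- The class `𝒮_{k,m}^n(z^n)` of tuples of single-symbol denoisers that shift at most
`min (n(c)) m` times along the times of each context `c`. -/
def shiftClass {n k : ℕ} (m : ℕ) (z : Fin n → Z) : Set (Window n k → Z → Y) :=
  {S | ∀ c : (Fin k → Z) × (Fin k → Z),
    numShifts (contextTimes z c) S ≤ min (contextTimes z c).card m}

/-- Estimated normalized cumulative loss of a tuple of single-symbol denoisers. -/
def estCumLoss [Fintype X] [Fintype Z] (W : Matrix X Z ℝ) (H : Matrix Z X ℝ) (Λ : X → Y → ℝ)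
    {n k : ℕ} (z : Fin n → Z) (S : Window n k → Z → Y) : ℝ :=
  (1 / ((n : ℝ) - 2 * k)) * ∑ t : Window n k, estLoss W H Λ (z t.1) (S t)

/-- `Shat` selects, for every `z^n`, a minimizer of the estimated loss over `𝒮_{k,m}^n(z^n)`
(with any rule for resolving ties). -/
def IsEstLossMinimizer [Fintype X] [Fintype Z] (W : Matrix X Z ℝ) (H : Matrix Z X ℝ)
    (Λ : X → Y → ℝ) {n k : ℕ} (m : ℕ) (Shat : (Fin n → Z) → Window n k → Z → Y) : Prop :=
  ∀ z, Shat z ∈ shiftClass m z ∧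
    ∀ S : Window n k → Z → Y, S ∈ shiftClass m z →
      estCumLoss W H Λ z (Shat z) ≤ estCumLoss W H Λ z S

/-- The `n`-block denoiser that applies the selected single-symbol denoisers in the window and
outputs the fixed symbol `y₀` outside of it. -/
def tupleDenoiser {n k : ℕ} (y₀ : Y) (Shat : (Fin n → Z) → Window n k → Z → Y) :
    BlockDenoiser Z Y n :=
  fun z t => if ht : k ≤ (t : ℕ) ∧ (t : ℕ) + k < n then Shat z ⟨t, ht⟩ (z t) else y₀

end Shifting

/-! ### The growth condition -/

section Growth

variable {X Z Y : Type*}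

/-- Maximum minus minimum of all the entries of a (finite) array. -/
def spread {ι κ : Type*} (f : ι → κ → ℝ) : ℝ :=
  (⨆ p : ι × κ, f p.1 p.2) - ⨅ p : ι × κ, f p.1 p.2

/-- `L_max = Λ_max + ℓ_max`. -/
def Lmax [Fintype X] [Fintype Z] (W : Matrix X Z ℝ) (H : Matrix Z X ℝ) (Λ : X → Y → ℝ) : ℝ :=
  spread Λ + spread (estLoss W H Λ)

open Classical in
/-- `2(k+1) exp(-(n-2k)[ε²/(2(k+1)L_max²) - 2|Z|^{2k}{h(m/(n-2k)) + (m+1) ln N/(n-2k)}])`, with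
`N` the number of single-symbol denoisers. In the degenerate case `L_max = 0` (constant loss)
`ε²/L_max²` is read as `+∞`, so that the value is `0`. -/
def deviationBound [Fintype X] [Fintype Z] (W : Matrix X Z ℝ) (H : Matrix Z X ℝ) (Λ : X → Y → ℝ)
    (ε : ℝ) (n k m : ℕ) : ℝ :=
  if Lmax W H Λ = 0 then 0 else
    2 * ((k : ℝ) + 1) * Real.exp (-((n : ℝ) - 2 * k) *
      (ε ^ 2 / (2 * ((k : ℝ) + 1) * Lmax W H Λ ^ 2) -
        2 * (Fintype.card Z : ℝ) ^ (2 * k) *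
          (Real.binEntropy ((m : ℝ) / ((n : ℝ) - 2 * k)) +
            ((m : ℝ) + 1) * Real.log (Nat.card (Z → Y)) / ((n : ℝ) - 2 * k))))

/-- The growth condition: eventually `k_n`, `m_n` are in the range `2 k_n < n`,
`m_n ≤ ⌊(n - 2 k_n) / 2⌋`, and for every `ε > 0` the deviation bound is summable in `n`. -/
def GrowthCondition [Fintype X] [Fintype Z] (W : Matrix X Z ℝ) (H : Matrix Z X ℝ)
    (Λ : X → Y → ℝ) (k m : ℕ → ℕ) : Prop :=
  (∀ᶠ n in atTop, 2 * k n < n ∧ m n ≤ (n - 2 * k n) / 2) ∧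
    ∀ ε : ℝ, 0 < ε → Summable fun n => deviationBound W H Λ ε n (k n) (m n)

end Growth

/-! ### Piecewise stationary processes -/

section Processes

variable {X : Type*}

/-- `r(a^n)`: the number of switches along `a_0, …, a_{n-1}`. -/
def switches {M : ℕ} (n : ℕ) (a : ℕ → Fin M) : ℕ :=
  ((Finset.range (n - 1)).filter fun j => a j ≠ a (j + 1)).card

/-- `t` is the last time of a block (maximal constant run) of `a^n`. -/
def IsBlockEnd {M n : ℕ} (a : Fin n → Fin M) (t : Fin n) : Prop :=
  ∀ h : (t : ℕ) + 1 < n, a t ≠ a ⟨(t : ℕ) + 1, h⟩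

/-- `s` lies in the block of `t` and not after `t`; for a block end `t` these `s` are exactly
the times of the block that ends at `t`. -/
def InBlock {M n : ℕ} (a : Fin n → Fin M) (s t : Fin n) : Prop :=
  s ≤ t ∧ ∀ u, s ≤ u → u ≤ t → a u = a t

open Classical in
/-- `P(X^n = x^n | A^n = a^n)`: the product over the blocks of `a^n`, each represented by its
last time `t`, of the probability under the process law `P (a t)` that the coordinates in the
block agree with `x^n`. -/
def condLaw [MeasurableSpace X] {M n : ℕ} (P : Fin M → Measure (ℕ → X)) (a : Fin n → Fin M)
    (x : Fin n → X) : ℝ :=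
  ∏ t ∈ Finset.univ.filter (IsBlockEnd a),
    (P (a t)).real {ω | ∀ s : Fin n, InBlock a s t → ω s = x s}

/-- A stationary process law: a shift-invariant probability measure on sequences. -/
def IsStationary [MeasurableSpace X] (P : Measure (ℕ → X)) : Prop :=
  IsProbabilityMeasure P ∧ MeasurePreserving (fun (ω : ℕ → X) (t : ℕ) => ω (t + 1)) P P

/-- The class `𝒫{m_n}`: laws of processes that switch among finitely many stationary processes
`P` according to a switching process of law `Q`, with at most `m n` switches by time `n`. -/
def PiecewiseStationary [MeasurableSpace X] (m : ℕ → ℕ) (PX : Measure (ℕ → X)) : Prop :=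
  IsProbabilityMeasure PX ∧
    ∃ (M : ℕ) (P : Fin M → Measure (ℕ → X)) (Q : Measure (ℕ → Fin M)),
      (∀ i, IsStationary (P i)) ∧ IsProbabilityMeasure Q ∧
      (∀ n, ∀ᵐ a ∂Q, switches n a ≤ m n) ∧
      ∀ (n : ℕ) (x : Fin n → X),
        marginal PX n x = ∑ a : Fin n → Fin M, marginal Q n a * condLaw P a x

end Processes

end

end SDude

open Filter Topology MeasureTheory

namespace SDude

noncomputable section

/-! Condition on the switching sequence `a`. It then suffices to bound the excess over an arbitrary
denoiser by a quantity that is uniform in `a` and tends to 0; averaging over `a`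
(`expectedLoss_mixture_le`) keeps the bound, because neither denoiser depends on `a`. Three
comparisons give it (`expectedLoss_condLaw_le`).

Estimation: since Π H = I, the difference between true and estimated loss at time t has mean zero
given all other outputs, even when the single-symbol denoiser depends on the context of t. Times in
one residue class mod k + 1 avoid each other's contexts, so exponential moments multiply along the
class. Summing these moments over codes for the shift class bounds the expected deviation of any
data-dependent selection, at a cost of the logarithm of the number of codes. Hence, for every clean
sequence, the minimizer of the estimated loss nearly matches any other selection
(`channelMean_loss_le`).

Achievability: the tuple that uses at time t the optimal radius-k window denoiser for the law P (a
t) lies in the shift class, because along a fixed context it changes only when `a` does. Away from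
switches and from the ends it incurs exactly `windowOpt` of radius k; the remaining times number
O((k+1)(m+1)) (`expectedLoss_windowTuple_le`).

Converse: fixing everything outside the block of t turns any denoiser into one for a stretch of a
stationary process, which fits into a window of radius n about t. Its risk is at least `windowOpt`
of radius n (`windowOpt_le_sum_condLaw`).

`windowOpt` decreases in the radius and is nonnegative, so its values at radii k_n and n have the
same limit. The growth condition enters only through the fact that a summable sequence is eventually
below 1, which forces `complexityRate` to 0; only expectations are needed, so no almost-sure
argument appears. -/

/-- The tuple that agrees with `u` on `B` and with `v` off `B`. -/
def glue {ι α : Type*} (B : ι → Prop) [DecidablePred B] (u v : ι → α) : ι → α :=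
  fun s => if B s then u s else v s

lemma glue_glue {ι α : Type*} (B : ι → Prop) [DecidablePred B] (u v : ι → α) :
    glue B (glue B u v) (glue B v u) = u := by
  funext s
  by_cases h : B s <;> simp [glue, h]

/-! ### Expectation over the output of the memoryless channel -/

section Channel

variable {X Z Y ι κ : Type*} [Fintype Z] [Fintype ι] [DecidableEq ι] [Fintype κ] [DecidableEq κ]

/-- Expectation of `f` under the output of the memoryless channel `W` with input tuple `x`. -/
def channelMean (W : Matrix X Z ℝ) (x : ι → X) (f : (ι → Z) → ℝ) : ℝ :=
  ∑ z : ι → Z, (∏ t, W (x t) (z t)) * f z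

variable {W : Matrix X Z ℝ}

lemma channelMean_const (hW : ∀ x, ∑ z, W x z = 1) (x : ι → X) (c : ℝ) :
    channelMean W x (fun _ => c) = c := by
  have h := Finset.prod_univ_sum (fun _ : ι => (Finset.univ : Finset Z)) (fun t z => W (x t) z)
  simp only [hW, Finset.prod_const_one, Fintype.piFinset_univ] at h
  rw [channelMean, ← Finset.sum_mul, ← h, one_mul]

lemma channelMean_mono (hW : ∀ x z, 0 ≤ W x z) (x : ι → X) {f g : (ι → Z) → ℝ}
    (h : ∀ z, f z ≤ g z) : channelMean W x f ≤ channelMean W x g :=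
  Finset.sum_le_sum fun z _ =>
    mul_le_mul_of_nonneg_left (h z) (Finset.prod_nonneg fun _ _ => hW _ _)

lemma channelMean_add (x : ι → X) (f g : (ι → Z) → ℝ) :
    channelMean W x (fun z => f z + g z) = channelMean W x f + channelMean W x g := by
  simp only [channelMean, mul_add, Finset.sum_add_distrib]

lemma channelMean_sub (x : ι → X) (f g : (ι → Z) → ℝ) :
    channelMean W x (fun z => f z - g z) = channelMean W x f - channelMean W x g := by
  simp only [channelMean, mul_sub, Finset.sum_sub_distrib]

lemma channelMean_mul_left (x : ι → X) (c : ℝ) (f : (ι → Z) → ℝ) :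
    channelMean W x (fun z => c * f z) = c * channelMean W x f := by
  simp only [channelMean, Finset.mul_sum]
  exact Finset.sum_congr rfl fun z _ => by ring

lemma channelMean_sum {α : Type*} (s : Finset α) (x : ι → X) (f : α → (ι → Z) → ℝ) :
    channelMean W x (fun z => ∑ i ∈ s, f i z) = ∑ i ∈ s, channelMean W x (f i) := by
  simp only [channelMean, Finset.mul_sum]
  exact Finset.sum_comm

/-- Marginalization: a function of the coordinates in the range of an injection `τ` only sees
the input on that range. -/
lemma channelMean_comp_injective (hW : ∀ x, ∑ z, W x z = 1) (x : κ → X) {τ : ι → κ}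
    (hτ : Function.Injective τ) (f : (ι → Z) → ℝ) :
    channelMean W x (fun z => f (fun i => z (τ i))) = channelMean W (fun i => x (τ i)) f := by
  classical
  have key : ∀ u : ι → Z, ∑ z : κ → Z with (fun i => z (τ i)) = u, ∏ t, W (x t) (z t) =
      ∏ i, W (x (τ i)) (u i) := by
    intro u
    have hset : (Finset.univ.filter fun z : κ → Z => (fun i => z (τ i)) = u) =
        Fintype.piFinset fun s => Finset.univ.filter fun w : Z => ∀ i, τ i = s → w = u i := by
      ext z
      simp only [Finset.mem_filter, Finset.mem_univ, true_and, Fintype.mem_piFinset, funext_iff]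
      exact ⟨fun h s i hi => hi ▸ h i, fun h i => h _ i rfl⟩
    rw [hset, ← Finset.prod_univ_sum]
    rw [← Finset.prod_subset (Finset.subset_univ (Finset.univ.image τ)),
      Finset.prod_image fun _ _ _ _ h => hτ h]
    · refine Finset.prod_congr rfl fun i _ => ?_
      rw [Finset.sum_eq_single_of_mem (u i)]
      · simp only [Finset.mem_filter, Finset.mem_univ, true_and]
        intro j hj
        rw [hτ hj]
      · intro b hb hne
        simp only [Finset.mem_filter, Finset.mem_univ, true_and] at hb
        exact absurd (hb i rfl) hne
    · intro s _ hs
      simp only [Finset.mem_image, Finset.mem_univ, true_and, not_exists] at hs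
      rw [Finset.filter_true_of_mem fun w _ i hi => absurd hi (hs i), hW]
  unfold channelMean
  rw [← Finset.sum_fiberwise Finset.univ (fun (z : κ → Z) (i : ι) => z (τ i))]
  refine Finset.sum_congr rfl fun u _ => ?_
  rw [← key u, Finset.sum_mul]
  refine Finset.sum_congr rfl fun z hz => ?_
  rw [← (Finset.mem_filter.1 hz).2]

/-- The output of a glued input is obtained by glueing independent outputs. -/
lemma channelMean_glue (hW : ∀ x, ∑ z, W x z = 1) (B : ι → Prop) [DecidablePred B]
    (x v : ι → X) (f : (ι → Z) → ℝ) :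
    channelMean W (glue B x v) f =
      channelMean W v (fun z' => channelMean W x (fun z => f (glue B z z'))) := by
  classical
  -- Exchanging the coordinates in `B` between two independent outputs is an involution that carries
  -- the weights of the inputs (v, x) to those of the glued inputs. The second glued output then no
  -- longer occurs in f and sums out to 1.
  let e : (ι → Z) × (ι → Z) ≃ (ι → Z) × (ι → Z) :=
    { toFun := fun p => (glue B p.2 p.1, glue B p.1 p.2)
      invFun := fun p => (glue B p.2 p.1, glue B p.1 p.2)
      left_inv := fun p => by simp only [glue_glue]
      right_inv := fun p => by simp only [glue_glue] }
  have hprod : ∀ p : (ι → Z) × (ι → Z),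
      (∏ t, W (v t) (p.1 t)) * (∏ t, W (x t) (p.2 t)) =
        (∏ t, W (glue B x v t) (glue B p.2 p.1 t)) *
          ∏ t, W (glue B v x t) (glue B p.1 p.2 t) := by
    intro p
    rw [← Finset.prod_mul_distrib, ← Finset.prod_mul_distrib]
    refine Finset.prod_congr rfl fun t _ => ?_
    by_cases h : B t <;> simp [glue, h, mul_comm]
  have h1 : channelMean W v (fun z' => channelMean W x (fun z => f (glue B z z'))) =
      ∑ p : (ι → Z) × (ι → Z), (∏ t, W (glue B x v t) ((e p).1 t)) *
          (∏ t, W (glue B v x t) ((e p).2 t)) * f (e p).1 := by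
    rw [Fintype.sum_prod_type]
    simp only [channelMean, Finset.mul_sum]
    refine Finset.sum_congr rfl fun z' _ => Finset.sum_congr rfl fun z _ => ?_
    have := hprod (z', z)
    simp only at this
    rw [← mul_assoc, this]
    rfl
  rw [h1, Equiv.sum_comp e (fun p => (∏ t, W (glue B x v t) (p.1 t)) *
          (∏ t, W (glue B v x t) (p.2 t)) * f p.1), Fintype.sum_prod_type]
  refine Finset.sum_congr rfl fun z _ => ?_
  have := channelMean_const hW (glue B v x) ((∏ t, W (glue B x v t) (z t)) * f z)
  rw [channelMean] at this
  rw [← this]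
  exact Finset.sum_congr rfl fun z' _ => by ring

/-- Resampling the output at a single time. -/
lemma channelMean_update (hW : ∀ x, ∑ z, W x z = 1) (x : ι → X) (t : ι) (f : (ι → Z) → ℝ) :
    channelMean W x f =
      channelMean W x (fun z => ∑ w, W (x t) w * f (Function.update z t w)) := by
  classical
  have h := channelMean_glue hW (fun s => s = t) x x f
  have hx : glue (fun s => s = t) x x = x := by funext s; simp [glue]
  rw [hx] at h
  rw [h]
  congr 1
  funext z'
  have h2 := channelMean_comp_injective hW x (τ := fun _ : Unit => t)
    (fun _ _ _ => rfl) (fun u => f (Function.update z' t (u ())))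
  have h3 : ∀ z : ι → Z, glue (fun s => s = t) z z' = Function.update z' t (z t) := by
    intro z
    funext s
    by_cases hs : s = t
    · subst hs; simp [glue]
    · simp [glue, hs]
  simp only [h3]
  rw [h2, channelMean, ← Equiv.sum_comp (Equiv.funUnique Unit Z).symm]
  simp

end Channel

/-! ### Coding tuples with few shifts -/

section Coding

variable {ι α : Type*} [LinearOrder ι]

/-- Consecutive pairs of `T` span disjoint half-open intervals of positions, so choosing a point of
`J` in the interval of each shift is injective. -/
lemma numShifts_le_of_forall_exists {T : Finset ι} {S : ι → α} {m : ℕ} (J : Finset ℕ)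
    (hJ : J.card ≤ m) (pos : ι → ℕ) (hpos : StrictMono pos)
    (h : ∀ s t, s < t → S s ≠ S t → s ∈ T → t ∈ T → ∃ j ∈ J, pos s ≤ j ∧ j < pos t) :
    numShifts T S ≤ m := by
  classical
  refine le_trans ?_ hJ
  have h' : ∀ p : ι × ι, ∃ j, p.1 < p.2 → S p.1 ≠ S p.2 → p.1 ∈ T → p.2 ∈ T →
      j ∈ J ∧ pos p.1 ≤ j ∧ j < pos p.2 := by
    intro p
    by_cases hp : p.1 < p.2 ∧ S p.1 ≠ S p.2 ∧ p.1 ∈ T ∧ p.2 ∈ T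
    · obtain ⟨j, hj⟩ := h p.1 p.2 hp.1 hp.2.1 hp.2.2.1 hp.2.2.2
      exact ⟨j, fun _ _ _ _ => hj⟩
    · exact ⟨0, fun h1 h2 h3 h4 => absurd ⟨h1, h2, h3, h4⟩ hp⟩
  choose f hf using h'
  refine Finset.card_le_card_of_injOn f ?_ ?_
  · intro p hp
    simp only [Finset.coe_filter, Finset.mem_product, Set.mem_ofPred_eq] at hp
    exact (hf p hp.2.1 hp.2.2.2 hp.1.1 hp.1.2).1
  · intro p hp q hq hpq
    simp only [Finset.coe_filter, Finset.mem_product, Set.mem_ofPred_eq] at hp hq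
    obtain ⟨-, hp1, hp2⟩ := hf p hp.2.1 hp.2.2.2 hp.1.1 hp.1.2
    obtain ⟨-, hq1, hq2⟩ := hf q hq.2.1 hq.2.2.2 hq.1.1 hq.1.2
    rw [hpq] at hp1 hp2
    have a1 : p.1 < q.2 := hpos.lt_iff_lt.1 (hp1.trans_lt hq2)
    have a2 : q.1 < p.2 := hpos.lt_iff_lt.1 (hq1.trans_lt hp2)
    have b1 : p.1 = q.1 := by
      rcases lt_trichotomy p.1 q.1 with h | h | h
      · exact absurd ⟨h, a2⟩ (hp.2.2.1 _ hq.1.1)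
      · exact h
      · exact absurd ⟨h, a1⟩ (hq.2.2.1 _ hp.1.1)
    have b2 : p.2 = q.2 := by
      rcases lt_trichotomy p.2 q.2 with h | h | h
      · exact absurd ⟨a2, h⟩ (hq.2.2.1 _ hp.1.2)
      · exact h
      · exact absurd ⟨a1, h⟩ (hp.2.2.1 _ hq.1.2)
    exact Prod.ext b1 b2

lemma numShifts_le_card (T : Finset ι) (S : ι → α) : numShifts T S ≤ T.card := by
  classical
  refine Finset.card_le_card_of_injOn Prod.snd ?_ ?_
  · intro p hp
    simp only [Finset.coe_filter, Finset.mem_product, Set.mem_ofPred_eq] at hp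
    exact hp.1.2
  · intro p hp q hq hpq
    simp only [Finset.coe_filter, Finset.mem_product, Set.mem_ofPred_eq] at hp hq
    refine Prod.ext ?_ hpq
    rcases lt_trichotomy p.1 q.1 with h | h | h
    · exact absurd ⟨h, hpq ▸ hq.2.1⟩ (hp.2.2.1 _ hq.1.1)
    · exact h
    · exact absurd ⟨h, hpq ▸ hp.2.1⟩ (hq.2.2.1 _ hp.1.1)

lemma card_le_numShifts {T J : Finset ι} {S : ι → α}
    (h : ∀ t ∈ J, t ∈ T ∧ ∃ u ∈ T, u < t ∧ (∀ v ∈ T, ¬ (u < v ∧ v < t)) ∧ S u ≠ S t) :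
    J.card ≤ numShifts T S := by
  classical
  refine le_trans (Finset.card_le_card ?_) (Finset.card_image_le (f := Prod.snd))
  intro t ht
  obtain ⟨htT, u, huT, h1, h2, h3⟩ := h t ht
  refine Finset.mem_image.2 ⟨(u, t), ?_, rfl⟩
  rw [Finset.mem_filter]
  exact ⟨Finset.mem_product.2 ⟨huT, htT⟩, h1, h2, h3⟩

variable [Fintype ι]

/-- The tuple that starts at `a` and jumps to `g u` at every time `u` where `g u` is defined. -/
def decode (a : α) (g : ι → Option α) (t : ι) : α :=
  if h : (Finset.univ.filter fun u => u ≤ t ∧ (g u).isSome).Nonempty then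
    (g ((Finset.univ.filter fun u => u ≤ t ∧ (g u).isSome).max' h)).getD a
  else a

lemma decode_of_some {a b : α} {g : ι → Option α} {t : ι} (h : g t = some b) :
    decode a g t = b := by
  have hmem : t ∈ Finset.univ.filter fun u => u ≤ t ∧ (g u).isSome := by simp [h]
  have hmax : (Finset.univ.filter fun u => u ≤ t ∧ (g u).isSome).max' ⟨t, hmem⟩ = t :=
    le_antisymm (Finset.max'_le _ _ _ fun u hu => (Finset.mem_filter.1 hu).2.1)
      (Finset.le_max' _ _ hmem)
  rw [decode, dif_pos ⟨t, hmem⟩, hmax, h]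
  rfl

lemma decode_congr {a : α} {g : ι → Option α} {s t : ι} (hst : s ≤ t)
    (h : ∀ u, s < u → u ≤ t → g u = none) : decode a g t = decode a g s := by
  have : (Finset.univ.filter fun u => u ≤ t ∧ (g u).isSome) =
      Finset.univ.filter fun u => u ≤ s ∧ (g u).isSome := by
    ext u
    simp only [Finset.mem_filter, Finset.mem_univ, true_and]
    refine ⟨fun hu => ⟨?_, hu.2⟩, fun hu => ⟨hu.1.trans hst, hu.2⟩⟩
    by_contra hsu
    have := h u (not_le.1 hsu) hu.1
    simp [this] at hu
  simp only [decode, this]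

lemma decode_of_forall_none {a : α} {g : ι → Option α} {t : ι}
    (h : ∀ u ≤ t, g u = none) : decode a g t = a := by
  rw [decode, dif_neg]
  rintro ⟨u, hu⟩
  have := (Finset.mem_filter.1 hu).2
  simp [h u this.1] at this

open Classical in
/-- Every tuple with few shifts along `T` is, on `T`, decoded from few jumps. -/
lemma exists_decode_eq [Nonempty α] (T : Finset ι) (S : ι → α) :
    ∃ (a : α) (g : ι → Option α),
      (Finset.univ.filter fun u => (g u).isSome).card ≤ numShifts T S ∧
        ∀ t ∈ T, decode a g t = S t := by
  -- The code records the new value of `S` at each shift along `T` and the value at the first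
  -- element of `T`. Decoding is checked by strong induction, passing from each element of `T` to
  -- its predecessor in `T`.
  let jump : ι → Prop := fun t => ∃ u ∈ T, u < t ∧ (∀ v ∈ T, ¬ (u < v ∧ v < t)) ∧ S u ≠ S t
  let g : ι → Option α := fun t => if t ∈ T ∧ jump t then some (S t) else none
  let a : α := if h : T.Nonempty then S (T.min' h) else Classical.arbitrary α
  refine ⟨a, g, ?_, ?_⟩
  · refine card_le_numShifts fun t ht => ?_
    by_contra hcon
    have hg : g t = none := if_neg hcon
    simp [hg] at ht
  · intro t
    induction t using WellFoundedLT.induction with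
    | ind t ih =>
      intro htT
      by_cases hj : jump t
      · exact decode_of_some (by simp [g, htT, hj])
      have hgt : g t = none := by simp [g, hj]
      by_cases hpre : (T.filter (· < t)).Nonempty
      · set u := (T.filter (· < t)).max' hpre with hu
        have huT : u ∈ T ∧ u < t := Finset.mem_filter.1 ((T.filter (· < t)).max'_mem hpre)
        have hcons : ∀ v ∈ T, ¬ (u < v ∧ v < t) := fun v hv hvv =>
          absurd ((T.filter (· < t)).le_max' v (Finset.mem_filter.2 ⟨hv, hvv.2⟩))
            (not_le.2 hvv.1)
        have hS : S u = S t := by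
          by_contra hne
          exact hj ⟨u, huT.1, huT.2, hcons, hne⟩
        rw [← hS, ← ih u huT.2 huT.1]
        refine decode_congr huT.2.le fun v huv hvt => ?_
        rcases hvt.eq_or_lt with rfl | hvt
        · exact hgt
        · have : v ∉ T := fun hv => hcons v hv ⟨huv, hvt⟩
          simp [g, this]
      · have hmin : ∀ v ∈ T, t ≤ v := by
          intro v hv
          by_contra hlt
          exact hpre ⟨v, Finset.mem_filter.2 ⟨hv, not_le.1 hlt⟩⟩
        have hT : T.Nonempty := ⟨t, htT⟩
        have ha : a = S t := by
          have : T.min' hT = t :=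
            le_antisymm (Finset.min'_le _ _ htT) (Finset.le_min' _ _ _ hmin)
          simp only [a, dif_pos hT, this]
        rw [← ha]
        refine decode_of_forall_none fun u hut => ?_
        rcases hut.eq_or_lt with rfl | hut
        · exact hgt
        · have : u ∉ T := fun hu => absurd (hmin u hu) (not_le.2 hut)
          simp [g, this]

open Classical in
/-- A Chernoff-type bound for the number of partial functions with a small domain. -/
lemma card_partial_functions_mul_pow_le {ι α : Type*} [Fintype ι] [Fintype α] (m : ℕ) {p : ℝ}
    (hp0 : 0 ≤ p) (hp1 : p ≤ 1) :
    (Nat.card {g : ι → Option α // (Finset.univ.filter fun u => (g u).isSome).card ≤ m} : ℝ) *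
        p ^ m ≤ (1 + p * Fintype.card α) ^ Fintype.card ι := by
  -- Weight each defined value by p: the total weight factorizes over the positions, while each
  -- function with at most m defined values has weight at least p ^ m.
  have h1 : ∑ g : ι → Option α, ∏ u, (if (g u).isSome then p else 1) =
      (1 + p * Fintype.card α) ^ Fintype.card ι := by
    have := Finset.prod_univ_sum (fun _ : ι => (Finset.univ : Finset (Option α)))
      (fun _ o => if o.isSome then p else (1 : ℝ))
    rw [Fintype.piFinset_univ] at this
    rw [← this]
    simp [Fintype.sum_option, mul_comm, add_comm]
  have h2 : ∀ g : ι → Option α, ∏ u, (if (g u).isSome then p else 1) =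
      p ^ (Finset.univ.filter fun u => (g u).isSome).card := by
    intro g
    simp [Finset.prod_ite]
  rw [← h1, Nat.card_eq_fintype_card, Fintype.card_subtype, ← nsmul_eq_mul, ← Finset.sum_const]
  refine (Finset.sum_le_sum (g := fun g : ι → Option α => ∏ u, (if (g u).isSome then p else 1))
    ?_).trans (Finset.sum_le_univ_sum_of_nonneg fun g => ?_)
  · intro g hg
    rw [h2]
    exact pow_le_pow_of_le_one hp0 hp1 (Finset.mem_filter.1 hg).2
  · rw [h2]
    positivity

end Coding

/-! ### Uniform deviations over the shift class, for a fixed clean sequence -/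

section Deviation

variable {X Z Y : Type*} [Fintype Z] {W : Matrix X Z ℝ} {n k : ℕ}

/-- The context of u omits u itself and reaches only to distance k. -/
lemma context_update {Z : Type*} (z : Fin n → Z) (w : Z) (t : Fin n) (u : Window n k)
    (h : t = u.1 ∨ (u.1 : ℕ) + k < t ∨ (t : ℕ) + k < u.1) :
    context (Function.update z t w) u = context z u := by
  have hu := u.2
  have hval : t = u.1 → (t : ℕ) = u.1 := fun h => congrArg _ h
  refine Prod.ext (funext fun i => ?_) (funext fun i => ?_) <;>
  · refine Function.update_of_ne (fun h' => ?_) _ _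
    have hi := i.2
    have := congrArg Fin.val h'
    simp only at this
    rcases h with h | h | h
    · have := hval h
      omega
    · omega
    · omega

/-- A centered, bounded variable on a finite probability space is sub-Gaussian. -/
lemma sum_mul_exp_le {p v : Z → ℝ} (hp : ∀ z, 0 ≤ p z) (hp1 : ∑ z, p z = 1)
    (hv : ∑ z, p z * v z = 0) {c r : ℝ} (hc : ∀ z, |v z| ≤ c) (hr : 0 ≤ r) (hrc : r * c ≤ 1) :
    ∑ z, p z * Real.exp (r * v z) ≤ Real.exp (r ^ 2 * c ^ 2) := by
  have h1 : ∀ z, Real.exp (r * v z) ≤ 1 + r * v z + r ^ 2 * c ^ 2 := by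
    intro z
    have habs : |r * v z| ≤ r * c := by
      rw [abs_mul, abs_of_nonneg hr]
      exact mul_le_mul_of_nonneg_left (hc z) hr
    have h2 := (abs_le.1 (Real.abs_exp_sub_one_sub_id_le (habs.trans hrc))).2
    have h3 : (r * v z) ^ 2 ≤ (r * c) ^ 2 := sq_le_sq' (abs_le.1 habs).1 (abs_le.1 habs).2
    rw [mul_pow r c] at h3
    linarith
  calc ∑ z, p z * Real.exp (r * v z)
      ≤ ∑ z, p z * (1 + r * v z + r ^ 2 * c ^ 2) :=
        Finset.sum_le_sum fun z _ => mul_le_mul_of_nonneg_left (h1 z) (hp z)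
    _ = ∑ z, p z + r * ∑ z, p z * v z + (r ^ 2 * c ^ 2) * ∑ z, p z := by
        rw [Finset.mul_sum, Finset.mul_sum, ← Finset.sum_add_distrib, ← Finset.sum_add_distrib]
        exact Finset.sum_congr rfl fun z _ => by ring
    _ = r ^ 2 * c ^ 2 + 1 := by rw [hp1, hv]; ring
    _ ≤ Real.exp (r ^ 2 * c ^ 2) := Real.add_one_le_exp _

/-- Exponential moments along times that do not lie in each other's contexts. -/
lemma channelMean_prod_exp_le (hW0 : ∀ x z, 0 ≤ W x z) (hW1 : ∀ x, ∑ z, W x z = 1)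
    (x : Fin n → X) {v : Window n k → (Z → Y) → Z → ℝ}
    (hv : ∀ t s, ∑ w, W (x t.1) w * v t s w = 0) {c r : ℝ} (hc : ∀ t s w, |v t s w| ≤ c)
    (hr : 0 ≤ r) (hrc : r * c ≤ 1)
    (G : (Fin k → Z) × (Fin k → Z) → Window n k → Z → Y) (T : Finset (Window n k))
    (hT : ∀ t ∈ T, ∀ u ∈ T, t ≠ u → (u.1 : ℕ) + k < t.1 ∨ (t.1 : ℕ) + k < u.1) :
    channelMean W x (fun z => ∏ t ∈ T, Real.exp (r * v t (G (context z t) t) (z t.1))) ≤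
      Real.exp (r ^ 2 * c ^ 2) ^ T.card := by
  classical
  induction T using Finset.induction_on with
  | empty => simp [channelMean_const hW1]
  | insert t T ht ih =>
    have ih' := ih fun a ha b hb => hT a (Finset.mem_insert_of_mem ha) b
      (Finset.mem_insert_of_mem hb)
    -- Average over the output at t alone: the context of t and all factors from the other times of
    -- `T` stay fixed, so only the one-symbol moment bound `sum_mul_exp_le` is needed.
    rw [channelMean_update hW1 x t.1, Finset.card_insert_of_notMem ht, pow_succ']
    refine le_trans ?_ (mul_le_mul_of_nonneg_left ih' (Real.exp_pos _).le)
    rw [← channelMean_mul_left]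
    refine channelMean_mono hW0 x fun z => ?_
    have hprod : ∀ w, ∏ u ∈ T, Real.exp (r * v u (G (context (Function.update z t.1 w) u) u)
          (Function.update z t.1 w u.1)) =
        ∏ u ∈ T, Real.exp (r * v u (G (context z u) u) (z u.1)) := by
      intro w
      refine Finset.prod_congr rfl fun u hu => ?_
      have hne : t ≠ u := fun h => ht (h ▸ hu)
      rw [context_update z w t.1 u (Or.inr (hT t (Finset.mem_insert_self _ _) u
        (Finset.mem_insert_of_mem hu) hne)),
        Function.update_of_ne fun h => hne (Subtype.ext h.symm)]
    simp only [Finset.prod_insert ht, hprod, context_update z _ t.1 t (Or.inl rfl),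
      Function.update_self, ← mul_assoc]
    rw [← Finset.sum_mul]
    exact mul_le_mul_of_nonneg_right (sum_mul_exp_le (hW0 _) (hW1 _) (hv t _) (hc t _) hr hrc)
      (Finset.prod_nonneg fun _ _ => (Real.exp_pos _).le)

/-- Distinct times with the same residue mod k + 1 differ by more than k, so neither lies in the
other's context. -/
lemma sum_window_mod (f : Window n k → ℝ) :
    ∑ t, f t = ∑ i ∈ Finset.range (k + 1),
      ∑ t ∈ Finset.univ.filter (fun t : Window n k => (t.1 : ℕ) % (k + 1) = i), f t :=
  (Finset.sum_fiberwise_of_maps_to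
    (fun _ _ => Finset.mem_range.2 (Nat.mod_lt _ (Nat.succ_pos k))) f).symm

/-- Expected value of the largest deviation over a finite family of context-dependent tuples of
single-symbol denoisers. -/
lemma channelMean_sum_le (hW0 : ∀ x z, 0 ≤ W x z) (hW1 : ∀ x, ∑ z, W x z = 1)
    (x : Fin n → X) {v : Window n k → (Z → Y) → Z → ℝ}
    (hv : ∀ t s, ∑ w, W (x t.1) w * v t s w = 0) {c r : ℝ} (hc : ∀ t s w, |v t s w| ≤ c)
    (hr : 0 < r) (hrc : r * c ≤ 1) {K : Type*} [Fintype K] [Nonempty K]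
    (G : K → (Fin k → Z) × (Fin k → Z) → Window n k → Z → Y) (S : (Fin n → Z) → Window n k → Z → Y)
    (hS : ∀ z, ∃ κ, ∀ t, S z t = G κ (context z t) t) :
    channelMean W x (fun z => ∑ t, v t (S z t) (z t.1)) ≤
      (k + 1) * Real.log (Fintype.card K) / r + r * c ^ 2 * Fintype.card (Window n k) := by
  classical
  have key : ∀ T : Finset (Window n k),
      (∀ t ∈ T, ∀ u ∈ T, t ≠ u → (u.1 : ℕ) + k < t.1 ∨ (t.1 : ℕ) + k < u.1) →
      channelMean W x (fun z => ∑ t ∈ T, v t (S z t) (z t.1)) ≤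
        Real.log (Fintype.card K) / r + r * c ^ 2 * T.card := by
    intro T hT
    set L : ℝ := Real.log (Fintype.card K) + r ^ 2 * c ^ 2 * T.card with hL
    have hKpos : (0 : ℝ) < Fintype.card K := by exact_mod_cast Fintype.card_pos
    have hexpL : Real.exp L = Fintype.card K * Real.exp (r ^ 2 * c ^ 2) ^ T.card := by
      rw [hL, Real.exp_add, Real.exp_log hKpos, mul_comm (r ^ 2 * c ^ 2), Real.exp_nat_mul]
    -- The tangent-line bound 1 + u ≤ exp u at u = r Σ - L plays the role of Jensen's inequality.
    -- The code selected by z is replaced by the sum over all codes, and L is chosen so that the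
    -- expected sum is at most exp L; hence the mean of r Σ is at most L.
    have hpt : ∀ z, r * ∑ t ∈ T, v t (S z t) (z t.1) ≤ (L - 1) + Real.exp (-L) *
        ∑ κ, ∏ t ∈ T, Real.exp (r * v t (G κ (context z t) t) (z t.1)) := by
      intro z
      obtain ⟨κ, hκ⟩ := hS z
      have h1 : Real.exp (r * ∑ t ∈ T, v t (S z t) (z t.1)) ≤
          ∑ κ, ∏ t ∈ T, Real.exp (r * v t (G κ (context z t) t) (z t.1)) := by
        rw [Finset.mul_sum, Real.exp_sum]
        simp only [hκ]
        exact Finset.single_le_sum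
          (f := fun κ => ∏ t ∈ T, Real.exp (r * v t (G κ (context z t) t) (z t.1)))
          (fun _ _ => Finset.prod_nonneg fun _ _ => (Real.exp_pos _).le) (Finset.mem_univ κ)
      have h2 := Real.add_one_le_exp (r * ∑ t ∈ T, v t (S z t) (z t.1) - L)
      rw [sub_eq_add_neg, Real.exp_add, mul_comm (Real.exp _)] at h2
      have h3 := mul_le_mul_of_nonneg_left h1 (Real.exp_pos (-L)).le
      linarith
    have h4 := channelMean_mono hW0 x hpt
    rw [channelMean_mul_left, channelMean_add, channelMean_const hW1, channelMean_mul_left,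
      channelMean_sum Finset.univ] at h4
    have h5 : ∑ κ, channelMean W x
        (fun z => ∏ t ∈ T, Real.exp (r * v t (G κ (context z t) t) (z t.1))) ≤ Real.exp L := by
      rw [hexpL]
      refine (Finset.sum_le_card_nsmul _ _ _ fun κ _ =>
        channelMean_prod_exp_le hW0 hW1 x hv hc hr.le hrc (G κ) T hT).trans ?_
      simp
    have h6 := mul_le_mul_of_nonneg_left h5 (Real.exp_pos (-L)).le
    rw [← Real.exp_add, neg_add_cancel, Real.exp_zero] at h6
    have h7 : r * channelMean W x (fun z => ∑ t ∈ T, v t (S z t) (z t.1)) ≤ L := by linarith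
    rw [← le_div_iff₀' hr] at h7
    refine h7.trans (le_of_eq ?_)
    rw [hL]
    field_simp
  simp only [sum_window_mod (n := n) (k := k)]
  rw [channelMean_sum]
  refine (Finset.sum_le_sum fun i _ => key _ ?_).trans (le_of_eq ?_)
  · intro t ht u hu hne
    have ht' := (Finset.mem_filter.1 ht).2
    have hu' := (Finset.mem_filter.1 hu).2
    have hne' : (t.1 : ℕ) ≠ u.1 := fun h => hne (Subtype.ext (Fin.ext h))
    have h1 := Nat.div_add_mod (t.1 : ℕ) (k + 1)
    have h2 := Nat.div_add_mod (u.1 : ℕ) (k + 1)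
    rcases lt_trichotomy ((t.1 : ℕ) / (k + 1)) ((u.1 : ℕ) / (k + 1)) with h | h | h
    · right
      have := Nat.mul_le_mul_left (k + 1) (Nat.succ_le_of_lt h)
      rw [Nat.succ_eq_add_one, mul_add] at this
      omega
    · exact absurd (by rw [← h1, ← h2, h, ht', hu']) hne'
    · left
      have := Nat.mul_le_mul_left (k + 1) (Nat.succ_le_of_lt h)
      rw [Nat.succ_eq_add_one, mul_add] at this
      omega
  · have hcard : ∑ i ∈ Finset.range (k + 1), ((Finset.univ.filter
        (fun t : Window n k => (t.1 : ℕ) % (k + 1) = i)).card : ℝ) =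
        Fintype.card (Window n k) := by
      have := sum_window_mod (n := n) (k := k) (fun _ => 1)
      simpa using this.symm
    rw [Finset.sum_add_distrib, ← Finset.mul_sum, hcard, Finset.sum_const, Finset.card_range,
      nsmul_eq_mul]
    push_cast
    ring

/-- The estimated loss is unbiased. -/
lemma sum_mul_estLoss [Fintype X] [DecidableEq X] {H : Matrix Z X ℝ} (hH : W * H = 1)
    (Λ : X → Y → ℝ) (s : Z → Y) (x : X) :
    ∑ w, W x w * (Λ x (s w) - estLoss W H Λ w s) = 0 := by
  have h1 : ∑ w, W x w * estLoss W H Λ w s = rho W Λ s x := by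
    simp only [estLoss, Finset.mul_sum, ← mul_assoc]
    rw [Finset.sum_comm]
    simp only [← Finset.sum_mul, ← Matrix.mul_apply, hH]
    simp [Matrix.one_apply]
  simp only [mul_sub, Finset.sum_sub_distrib, h1, rho]
  rw [sub_eq_zero]
  exact Finset.sum_congr rfl fun w _ => mul_comm _ _

/-- Codes for the tuples of the shift class: for every context a start value and at most `m`
jumps. -/
abbrev ShiftCode (Z Y : Type*) (n k m : ℕ) :=
  (Fin k → Z) × (Fin k → Z) →
    (Z → Y) × {g : Window n k → Option (Z → Y) //
      (Finset.univ.filter fun u => (g u).isSome).card ≤ m}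

lemma exists_shiftCode {Z Y : Type*} [Nonempty Y] {m : ℕ} {z : Fin n → Z}
    {S : Window n k → Z → Y} (hS : S ∈ shiftClass m z) :
    ∃ κ : ShiftCode Z Y n k m, ∀ t, S t = decode (κ (context z t)).1 (κ (context z t)).2.1 t := by
  classical
  have h := fun c => exists_decode_eq (contextTimes z c) S
  choose a g hg hd using h
  refine ⟨fun c => (a c, ⟨g c, ?_⟩), fun t => ?_⟩
  · exact (hg c).trans ((hS c).trans (min_le_right _ _))
  · exact (hd (context z t) t (by simp [contextTimes])).symm

lemma card_window (h : 2 * k ≤ n) : Fintype.card (Window n k) = n - 2 * k := by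
  rw [← Fintype.card_fin (n - 2 * k)]
  refine Fintype.card_congr
    { toFun := fun t => ⟨(t.1 : ℕ) - k, by have := t.2; omega⟩
      invFun := fun i => ⟨⟨i + k, by have := i.2; omega⟩, by have := i.2; simp only; omega⟩
      left_inv := fun t => Subtype.ext (Fin.ext (Nat.sub_add_cancel t.2.1))
      right_inv := fun i => Fin.ext (Nat.add_sub_cancel _ _) }

/-- There are |Z|^(2k) contexts, each with a start value and a partial function. The count of
partial functions is bounded with weight p = m / w, w being the window size: -m log p is one of the
two terms of w h(p), and (1 + pN)^w ≤ exp(N m). -/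
lemma log_card_shiftCode_le [Fintype Y] [Nonempty Y] {m : ℕ} (hm : m ≤ Fintype.card (Window n k)) :
    Real.log (Nat.card (ShiftCode Z Y n k m)) ≤ (Fintype.card Z : ℝ) ^ (2 * k) *
      (Real.log (Nat.card (Z → Y)) +
        Fintype.card (Window n k) * Real.binEntropy ((m : ℝ) / Fintype.card (Window n k)) +
          Nat.card (Z → Y) * m) := by
  classical
  set w := Fintype.card (Window n k) with hw
  set N := Fintype.card (Z → Y) with hN
  set B := Nat.card {g : Window n k → Option (Z → Y) //
      (Finset.univ.filter fun u => (g u).isSome).card ≤ m} with hB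
  have hcard : Nat.card (ShiftCode Z Y n k m) = (N * B) ^ (Fintype.card Z ^ (2 * k)) := by
    have hctx : Nat.card ((Fin k → Z) × (Fin k → Z)) = Fintype.card Z ^ (2 * k) := by
      rw [Nat.card_prod, Nat.card_fun, Nat.card_fin, ← pow_add, ← two_mul,
        Nat.card_eq_fintype_card]
    rw [Nat.card_fun, Nat.card_prod, hctx, hN, ← Nat.card_eq_fintype_card (α := Z → Y)]
  have hBpos : 0 < B := by
    rw [hB, Nat.card_pos_iff]
    exact ⟨⟨⟨fun _ => none, by simp⟩⟩, inferInstance⟩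
  have hNpos : 0 < N := Fintype.card_pos
  set p : ℝ := (m : ℝ) / w with hp
  have hp0 : 0 ≤ p := by positivity
  have hp1 : p ≤ 1 := div_le_one_of_le₀ (by exact_mod_cast hm) (Nat.cast_nonneg _)
  have hwp : (w : ℝ) * p = m := by
    rcases Nat.eq_zero_or_pos w with h0 | h0
    · have : m = 0 := by omega
      simp [h0, this]
    · rw [hp]; field_simp
  have hpm : 0 < p ^ m := by
    rcases Nat.eq_zero_or_pos m with h0 | h0
    · simp [h0]
    · have : 0 < w := by omega
      positivity
  have hlogB : Real.log B ≤ w * Real.binEntropy p + N * m := by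
    have h1 := card_partial_functions_mul_pow_le (ι := Window n k) (α := Z → Y) m hp0 hp1
    rw [← hB, ← hN, ← hw] at h1
    have h2 : (1 + p * (N : ℝ)) ^ w ≤ Real.exp (N * m) := by
      have : Real.exp ((N : ℝ) * m) = Real.exp (p * N) ^ w := by
        rw [← Real.exp_nat_mul, ← hwp]
        ring_nf
      rw [this]
      refine pow_le_pow_left₀ (by positivity) ?_ _
      rw [add_comm]
      exact Real.add_one_le_exp _
    have h3 := Real.log_le_log (mul_pos (by exact_mod_cast hBpos) hpm) (h1.trans h2)
    rw [Real.log_exp, Real.log_mul (by exact_mod_cast hBpos.ne') hpm.ne', Real.log_pow] at h3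
    have h4 : -(m * Real.log p) ≤ w * Real.binEntropy p := by
      have h5 : 0 ≤ (1 - p) * Real.log (1 - p)⁻¹ := by
        rw [Real.log_inv]
        have := Real.log_nonpos (sub_nonneg.2 hp1) (by linarith)
        nlinarith
      rw [Real.binEntropy, Real.log_inv p, mul_add, ← mul_assoc, hwp]
      have : 0 ≤ (w : ℝ) * ((1 - p) * Real.log (1 - p)⁻¹) := by positivity
      linarith
    linarith
  rw [hcard, Nat.card_eq_fintype_card, ← hN]
  push_cast
  rw [Real.log_pow, Real.log_mul (by exact_mod_cast hNpos.ne') (by exact_mod_cast hBpos.ne')]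
  push_cast
  refine mul_le_mul_of_nonneg_left ?_ (by positivity)
  linarith

lemma sum_tupleDenoiser {Z : Type*} (Λ : X → Y → ℝ) (y₀ : Y) (S : (Fin n → Z) → Window n k → Z → Y)
    (x : Fin n → X) (z : Fin n → Z) :
    ∑ t, Λ (x t) (tupleDenoiser y₀ S z t) = ∑ t : Window n k, Λ (x t.1) (S z t (z t.1)) +
      ∑ t : {t : Fin n // ¬ (k ≤ (t : ℕ) ∧ (t : ℕ) + k < n)}, Λ (x t.1) y₀ := by
  rw [← Fintype.sum_subtype_add_sum_subtype (fun t : Fin n => k ≤ (t : ℕ) ∧ (t : ℕ) + k < n)]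
  congr 1
  · refine Finset.sum_congr rfl fun t _ => ?_
    rw [tupleDenoiser, dif_pos t.2]
  · refine Finset.sum_congr rfl fun t _ => ?_
    rw [tupleDenoiser, dif_neg t.2]

/-- For every clean sequence, minimizing the estimated loss is almost as good, in expectation, as
any other selection from the shift class. -/
lemma channelMean_loss_le [Fintype X] [DecidableEq X] [Fintype Y] (hW0 : ∀ x z, 0 ≤ W x z)
    (hW1 : ∀ x, ∑ z, W x z = 1) {H : Matrix Z X ℝ} (hH : W * H = 1) {Λ : X → Y → ℝ} {m : ℕ}
    (hkn : 2 * k < n) (hm : m ≤ n - 2 * k) (y₀ : Y) {Shat S : (Fin n → Z) → Window n k → Z → Y}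
    (hShat : IsEstLossMinimizer W H Λ m Shat) (hS : ∀ z, S z ∈ shiftClass m z) {c r : ℝ}
    (hc : ∀ x s w, |Λ x (s w) - estLoss W H Λ w s| ≤ c) (hr : 0 < r) (hrc : r * c ≤ 1)
    (x : Fin n → X) :
    channelMean W x (fun z => loss Λ (tupleDenoiser y₀ Shat) x z) ≤
      channelMean W x (fun z => loss Λ (tupleDenoiser y₀ S) x z) +
        2 * (r⁻¹ * ((k + 1) * (Fintype.card Z : ℝ) ^ (2 * k) *
          (Real.binEntropy ((m : ℝ) / ((n : ℝ) - 2 * k)) +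
            (Real.log (Nat.card (Z → Y)) + Nat.card (Z → Y) * m) / ((n : ℝ) - 2 * k))) +
              r * c ^ 2) := by
  classical
  have : Nonempty Y := ⟨y₀⟩
  have hw := card_window (n := n) (k := k) hkn.le
  have hwR : (Fintype.card (Window n k) : ℝ) = (n : ℝ) - 2 * k := by
    rw [hw, Nat.cast_sub hkn.le]; push_cast; ring
  have hw0 : (0 : ℝ) < (n : ℝ) - 2 * k := by
    rw [← hwR, hw]
    exact_mod_cast Nat.sub_pos_of_lt hkn
  have hn0 : (0 : ℝ) < n := by exact_mod_cast (by omega : 0 < n)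
  have : Nonempty (ShiftCode Z Y n k m) :=
    ⟨fun _ => (fun _ => y₀, ⟨fun _ => none, by simp⟩)⟩
  let V : Window n k → (Z → Y) → Z → ℝ := fun t s w => Λ (x t.1) (s w) - estLoss W H Λ w s
  -- The losses outside the window cancel, and minimality lets the two estimated losses be
  -- subtracted. What remains is one deviation for `Shat` and one, with opposite sign, for `S`;
  -- hence the factor 2.
  have hpt : ∀ z, loss Λ (tupleDenoiser y₀ Shat) x z - loss Λ (tupleDenoiser y₀ S) x z ≤
      1 / (n : ℝ) * (∑ t, V t (Shat z t) (z t.1) + ∑ t, -V t (S z t) (z t.1)) := by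
    intro z
    rw [loss, loss, sum_tupleDenoiser, sum_tupleDenoiser, ← mul_sub]
    refine mul_le_mul_of_nonneg_left ?_ (by positivity)
    have h1 := (hShat z).2 (S z) (hS z)
    rw [estCumLoss, estCumLoss] at h1
    have h2 := le_of_mul_le_mul_left h1 (by positivity)
    simp only [V, Finset.sum_neg_distrib, Finset.sum_sub_distrib]
    linarith
  have hdec : ∀ S' : (Fin n → Z) → Window n k → Z → Y, (∀ z, S' z ∈ shiftClass m z) →
      ∀ z, ∃ κ : ShiftCode Z Y n k m, ∀ t, S' z t =
        (fun (κ : ShiftCode Z Y n k m) c t => decode (κ c).1 (κ c).2.1 t) κ (context z t) t :=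
    fun S' h z => exists_shiftCode (h z)
  have h1 := channelMean_sum_le hW0 hW1 x (v := V)
    (fun t s => sum_mul_estLoss hH Λ s (x t.1)) (fun t s w => hc _ s w) hr hrc
    (fun (κ : ShiftCode Z Y n k m) c t => decode (κ c).1 (κ c).2.1 t) Shat
    (hdec Shat fun z => (hShat z).1)
  have h2 := channelMean_sum_le hW0 hW1 x (v := fun t s w => -V t s w)
    (fun t s => by
      simp only [mul_neg, Finset.sum_neg_distrib]
      rw [neg_eq_zero]
      exact sum_mul_estLoss hH Λ s (x t.1))
    (fun t s w => by rw [abs_neg]; exact hc _ s w) hr hrc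
    (fun (κ : ShiftCode Z Y n k m) c t => decode (κ c).1 (κ c).2.1 t) S (hdec S hS)
  have h3 := channelMean_mono hW0 x hpt
  rw [channelMean_sub, channelMean_mul_left, channelMean_add] at h3
  have hlog := log_card_shiftCode_le (Z := Z) (Y := Y) (n := n) (k := k) (m := m)
    (by rw [hw]; exact hm)
  rw [Nat.card_eq_fintype_card, hwR] at hlog
  rw [hwR] at h1 h2
  set Q := (Fintype.card Z : ℝ) ^ (2 * k)
  set L := Real.log (Fintype.card (ShiftCode Z Y n k m))
  set E := Real.binEntropy ((m : ℝ) / ((n : ℝ) - 2 * k))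
  set F := Real.log (Nat.card (Z → Y)) + Nat.card (Z → Y) * m
  have h4 : ((k : ℝ) + 1) * L / r + r * c ^ 2 * ((n : ℝ) - 2 * k) ≤
      ((n : ℝ) - 2 * k) * (r⁻¹ * ((k + 1) * Q * (E + F / ((n : ℝ) - 2 * k))) + r * c ^ 2) := by
    have : ((k : ℝ) + 1) * L / r ≤ ((k : ℝ) + 1) * (Q * (F + ((n : ℝ) - 2 * k) * E)) / r := by
      gcongr
      refine hlog.trans (le_of_eq ?_)
      simp only [F]
      ring
    refine (add_le_add_left this _).trans (le_of_eq ?_)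
    have hw' := hw0.ne'
    clear_value E F
    generalize (n : ℝ) - 2 * k = d at hw' ⊢
    field_simp
    ring
  have hpos : 0 ≤ r⁻¹ * ((k + 1) * Q * (E + F / ((n : ℝ) - 2 * k))) + r * c ^ 2 := by
    have hE : 0 ≤ E := by
      refine Real.binEntropy_nonneg (by positivity) (div_le_one_of_le₀ ?_ hw0.le)
      rw [← hwR, hw]
      exact_mod_cast hm
    have hF : 0 ≤ F := by positivity
    positivity
  have h5 : ((n : ℝ) - 2 * k) * (r⁻¹ * ((k + 1) * Q * (E + F / ((n : ℝ) - 2 * k))) + r * c ^ 2) ≤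
      n * (r⁻¹ * ((k + 1) * Q * (E + F / ((n : ℝ) - 2 * k))) + r * c ^ 2) :=
    mul_le_mul_of_nonneg_right (by linarith [(Nat.cast_nonneg k : (0 : ℝ) ≤ k)]) hpos
  have h6 := mul_le_mul_of_nonneg_left
    (add_le_add (h1.trans (h4.trans h5)) (h2.trans (h4.trans h5)))
    (by positivity : (0 : ℝ) ≤ 1 / n)
  rw [← mul_add, ← mul_assoc, one_div_mul_cancel hn0.ne', one_mul] at h6
  rw [← sub_le_iff_le_add']
  exact h3.trans (h6.trans (le_of_eq (two_mul _).symm))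

end Deviation

/-! ### Block structure of the conditional laws -/

section Blocks

variable {X : Type*} {M n : ℕ}

/-- Take the largest u such that `a` is constant from t to u; if `a` kept its value one step
further, u would not be largest. -/
lemma exists_isBlockEnd (a : Fin n → Fin M) (t : Fin n) :
    ∃ e, IsBlockEnd a e ∧ InBlock a t e ∧
      ∀ u, t ≤ u → (∀ v, t ≤ v → v ≤ u → a v = a t) → u ≤ e := by
  classical
  let U : Finset (Fin n) := Finset.univ.filter fun u => t ≤ u ∧ ∀ v, t ≤ v → v ≤ u → a v = a t
  have hU : ∀ u, u ∈ U ↔ t ≤ u ∧ ∀ v, t ≤ v → v ≤ u → a v = a t := fun u => by simp [U]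
  have ht : t ∈ U := (hU t).2 ⟨le_rfl, fun v h1 h2 => by rw [le_antisymm h2 h1]⟩
  obtain ⟨h1, h2⟩ := (hU _).1 (U.max'_mem ⟨t, ht⟩)
  set e := U.max' ⟨t, ht⟩
  refine ⟨e, fun h heq => ?_, ⟨h1, fun u hu1 hu2 => (h2 u hu1 hu2).trans (h2 e h1 le_rfl).symm⟩,
    fun u hu1 hu2 => U.le_max' u ((hU u).2 ⟨hu1, hu2⟩)⟩
  have hmem : (⟨(e : ℕ) + 1, h⟩ : Fin n) ∈ U := by
    refine (hU _).2 ⟨h1.trans (Fin.le_def.2 (Nat.le_succ _)), fun v hv1 hv2 => ?_⟩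
    rcases hv2.eq_or_lt with rfl | hv2
    · rw [← heq, h2 e h1 le_rfl]
    · exact h2 v hv1 (Fin.le_def.2 (Nat.lt_succ_iff.1 (Fin.lt_def.1 hv2)))
  have := Fin.le_def.1 (U.le_max' _ hmem)
  simp only at this
  omega

/-- The last time of the block of `t`. -/
def blockEnd (a : Fin n → Fin M) (t : Fin n) : Fin n := (exists_isBlockEnd a t).choose

lemma isBlockEnd_blockEnd (a : Fin n → Fin M) (t : Fin n) : IsBlockEnd a (blockEnd a t) :=
  (exists_isBlockEnd a t).choose_spec.1

lemma inBlock_blockEnd (a : Fin n → Fin M) (t : Fin n) : InBlock a t (blockEnd a t) :=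
  (exists_isBlockEnd a t).choose_spec.2.1

lemma apply_blockEnd (a : Fin n → Fin M) (t : Fin n) : a (blockEnd a t) = a t :=
  ((inBlock_blockEnd a t).2 t le_rfl (inBlock_blockEnd a t).1).symm

lemma inBlock_iff_blockEnd_eq {a : Fin n → Fin M} {s e : Fin n} (he : IsBlockEnd a e) :
    InBlock a s e ↔ blockEnd a s = e := by
  have key : ∀ e e' : Fin n, IsBlockEnd a e → InBlock a s e → InBlock a s e' → ¬ e < e' := by
    intro e e' he h h' hlt
    have hlt' := Fin.lt_def.1 hlt
    have hn : (e : ℕ) + 1 < n := by omega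
    refine he hn ?_
    rw [h'.2 e h.1 hlt.le,
      h'.2 ⟨(e : ℕ) + 1, hn⟩ (h.1.trans (Fin.le_def.2 (Nat.le_succ _))) (Fin.le_def.2 hlt')]
  refine ⟨fun h => le_antisymm ?_ ?_, fun h => h ▸ inBlock_blockEnd a s⟩
  · exact not_lt.1 (key _ _ he h (inBlock_blockEnd a s))
  · exact not_lt.1 (key _ _ (isBlockEnd_blockEnd a s) (inBlock_blockEnd a s) h)

/-- Times around `t` between which `a` is constant lie in the block of `t`. -/
lemma inBlock_of_const {a : Fin n → Fin M} {s t u : Fin n} (htu : t ≤ u)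
    (h : ∀ v, s ≤ v → v ≤ u → a v = a t) (hts : s ≤ t) {w : Fin n} (hw : s ≤ w) (hwu : w ≤ u) :
    InBlock a w (blockEnd a t) := by
  have hue : u ≤ blockEnd a t :=
    (exists_isBlockEnd a t).choose_spec.2.2 u htu fun v h1 h2 => h v (hts.trans h1) h2
  refine ⟨hwu.trans hue, fun v hv1 hv2 => ?_⟩
  rcases le_total v t with hvt | hvt
  · rw [h v (hw.trans hv1) (hvt.trans htu), apply_blockEnd a t]
  · exact (inBlock_blockEnd a t).2 v hvt hv2

/-- Replacing one coordinate of a product measure by an independent copy. -/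
lemma map_update_prod_pi {ι : Type*} [Fintype ι] [DecidableEq ι] {α : ι → Type*}
    [∀ i, MeasurableSpace (α i)] (μ : ∀ i, Measure (α i)) [∀ i, IsProbabilityMeasure (μ i)]
    (e : ι) : MeasurePreserving (fun p : (∀ i, α i) × α e => Function.update p.1 e p.2)
      ((Measure.pi μ).prod (μ e)) (Measure.pi μ) := by
  have hmeas : Measurable fun p : (∀ i, α i) × α e => Function.update p.1 e p.2 := by
    refine measurable_pi_iff.2 fun i => ?_
    by_cases h : i = e
    · subst h
      simpa using measurable_snd
    · simp only [Function.update_of_ne h]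
      exact (measurable_pi_apply i).comp measurable_fst
  refine ⟨hmeas, (Measure.pi_eq fun s hs => ?_).symm⟩
  have hpre : (fun p : (∀ i, α i) × α e => Function.update p.1 e p.2) ⁻¹' Set.univ.pi s =
      (Set.univ.pi (Function.update s e Set.univ)) ×ˢ s e := by
    ext p
    simp only [Set.mem_preimage, Set.mem_pi, Set.mem_univ, forall_true_left, Set.mem_prod]
    constructor
    · intro h
      refine ⟨fun i => ?_, by simpa using h e⟩
      by_cases hi : i = e
      · subst hi; simp
      · simpa [Function.update_of_ne hi] using h i
    · rintro ⟨h1, h2⟩ i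
      by_cases hi : i = e
      · subst hi; simpa using h2
      · simpa [Function.update_of_ne hi] using h1 i
  rw [Measure.map_apply hmeas (MeasurableSet.univ_pi hs), hpre, Measure.prod_prod, Measure.pi_pi,
    ← Finset.mul_prod_erase Finset.univ _ (Finset.mem_univ e),
    ← Finset.mul_prod_erase Finset.univ (fun i => μ i (s i)) (Finset.mem_univ e), mul_comm]
  simp only [Function.update_self, measure_univ, one_mul]
  congr 1
  exact Finset.prod_congr rfl fun i hi => by rw [Function.update_of_ne (Finset.ne_of_mem_erase hi)]

variable [MeasurableSpace X]

/-- The tuple whose blocks are read from independent sequences, one for each block end. -/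
def blockTuple (a : Fin n → Fin M) (ω : Fin n → ℕ → X) : Fin n → X :=
  fun s => ω (blockEnd a s) s

lemma measurable_blockTuple (a : Fin n → Fin M) :
    Measurable (blockTuple a : (Fin n → ℕ → X) → Fin n → X) :=
  measurable_pi_iff.2 fun s => (measurable_pi_apply (s : ℕ)).comp (measurable_pi_apply _)

/-- Realizes the conditional law on a product space with one independent sequence per time;
sequences attached to times that are not block ends are never read and contribute mass 1. -/
lemma condLaw_eq (P : Fin M → Measure (ℕ → X)) [∀ i, IsProbabilityMeasure (P i)]
    (a : Fin n → Fin M) (x : Fin n → X) :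
    condLaw P a x =
      (Measure.pi fun e => P (a e)).real {ω | ∀ s, blockTuple a ω s = x s} := by
  classical
  have hset : {ω : Fin n → ℕ → X | ∀ s, blockTuple a ω s = x s} = Set.univ.pi fun e =>
      if IsBlockEnd a e then {ω : ℕ → X | ∀ s : Fin n, InBlock a s e → ω s = x s}
      else Set.univ := by
    ext ω
    simp only [Set.mem_ofPred_eq, Set.mem_pi, Set.mem_univ, forall_true_left, blockTuple]
    constructor
    · intro h e
      by_cases he : IsBlockEnd a e
      · rw [if_pos he]
        intro s hs
        rw [← (inBlock_iff_blockEnd_eq he).1 hs]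
        exact h s
      · rw [if_neg he]
        trivial
    · intro h s
      have := h (blockEnd a s)
      rw [if_pos (isBlockEnd_blockEnd a s)] at this
      exact this s (inBlock_blockEnd a s)
  rw [hset, measureReal_def, Measure.pi_pi, ENNReal.toReal_prod, condLaw, Finset.prod_filter]
  refine Finset.prod_congr rfl fun e _ => ?_
  by_cases he : IsBlockEnd a e <;> simp [he, measureReal_def]

lemma condLaw_nonneg (P : Fin M → Measure (ℕ → X)) (a : Fin n → Fin M) (x : Fin n → X) :
    0 ≤ condLaw P a x :=
  Finset.prod_nonneg fun _ _ => measureReal_nonneg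

variable [DiscreteMeasurableSpace X] [Fintype X]

lemma integral_comp_eq_sum {Ω ι : Type*} [MeasurableSpace Ω] [Fintype ι] [DecidableEq ι]
    (μ : Measure Ω) [IsProbabilityMeasure μ] {ξ : Ω → ι → X} (hξ : Measurable ξ)
    (F : (ι → X) → ℝ) : ∫ ω, F (ξ ω) ∂μ = ∑ x, μ.real {ω | ∀ s, ξ ω s = x s} * F x := by
  have := Measure.isProbabilityMeasure_map (μ := μ) hξ.aemeasurable
  rw [← integral_map hξ.aemeasurable (Measurable.of_discrete.aestronglyMeasurable),
    integral_fintype Integrable.of_finite]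
  refine Finset.sum_congr rfl fun x _ => ?_
  rw [map_measureReal_apply hξ (measurableSet_singleton x), smul_eq_mul]
  congr 2
  ext ω
  simp [funext_iff]

lemma integrable_comp {Ω ι : Type*} [MeasurableSpace Ω] [Fintype ι]
    (μ : Measure Ω) [IsProbabilityMeasure μ] {ξ : Ω → ι → X} (hξ : Measurable ξ)
    (F : (ι → X) → ℝ) : Integrable (fun ω => F (ξ ω)) μ := by
  have := Measure.isProbabilityMeasure_map (μ := μ) hξ.aemeasurable
  exact (Integrable.of_finite (f := F)).comp_measurable hξ

lemma sum_condLaw_mul (P : Fin M → Measure (ℕ → X)) [∀ i, IsProbabilityMeasure (P i)]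
    (a : Fin n → Fin M) (F : (Fin n → X) → ℝ) :
    ∑ x, condLaw P a x * F x = ∫ ω, F (blockTuple a ω) ∂(Measure.pi fun e => P (a e)) := by
  classical
  rw [integral_comp_eq_sum _ (measurable_blockTuple a)]
  simp only [condLaw_eq]

lemma sum_condLaw (P : Fin M → Measure (ℕ → X)) [∀ i, IsProbabilityMeasure (P i)]
    (a : Fin n → Fin M) : ∑ x, condLaw P a x = 1 := by
  simpa using sum_condLaw_mul P a (fun _ => 1)

open Classical in
/-- The conditional law is invariant under resampling a block. -/
lemma sum_condLaw_mul_resample (P : Fin M → Measure (ℕ → X)) [∀ i, IsProbabilityMeasure (P i)]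
    (a : Fin n → Fin M) (F : (Fin n → X) → ℝ) {e : Fin n} (he : IsBlockEnd a e) :
    ∑ x, condLaw P a x * F x = ∑ v, condLaw P a v *
      ∫ ω, F (glue (fun s => InBlock a s e) (fun s => ω s) v) ∂(P (a e)) := by
  have hglue : ∀ (ω : Fin n → ℕ → X) (η : ℕ → X), blockTuple a (Function.update ω e η) =
      glue (fun s => InBlock a s e) (fun s => η s) (blockTuple a ω) := by
    intro ω η
    funext s
    by_cases h : blockEnd a s = e
    · subst h
      simp [blockTuple, glue, inBlock_blockEnd]
    · have h' : ¬ InBlock a s e := fun h2 => h ((inBlock_iff_blockEnd_eq he).1 h2)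
      simp [blockTuple, glue, h', Function.update_of_ne h]
  have hmp := map_update_prod_pi (fun e => P (a e)) e
  -- An independent copy of the sequence at e preserves the product measure, and by `hglue` it
  -- changes exactly the block ending at e.
  have h1 : ∫ ω, F (blockTuple a ω) ∂(Measure.pi fun e => P (a e)) =
      ∫ p, F (blockTuple a (Function.update p.1 e p.2))
        ∂((Measure.pi fun e => P (a e)).prod (P (a e))) := by
    conv_lhs => rw [← hmp.map_eq]
    exact integral_map hmp.measurable.aemeasurable
      (((Measurable.of_discrete (f := F)).comp (measurable_blockTuple a)).aestronglyMeasurable)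
  have hint := integrable_comp ((Measure.pi fun e => P (a e)).prod (P (a e)))
    ((measurable_blockTuple a).comp hmp.measurable) F
  rw [sum_condLaw_mul, sum_condLaw_mul P a (fun v =>
    ∫ ω, F (glue (fun s => InBlock a s e) (fun s => ω s) v) ∂(P (a e))), h1]
  refine (integral_prod _ hint).trans ?_
  simp only [Function.comp_apply, hglue]

end Blocks

/-! ### Optimal window denoising of a stationary process -/

section WindowRisk

variable {X Z Y : Type*} [Fintype Z]

/-- Expected loss at the centre of a window of length `2 K + 1`, for the denoiser `g` of that
window. -/
def windowRisk [MeasurableSpace X] (W : Matrix X Z ℝ) (Λ : X → Y → ℝ) (P : Measure (ℕ → X)) (K : ℕ)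
    (g : (Fin (2 * K + 1) → Z) → Y) : ℝ :=
  ∫ ω, channelMean W (fun i : Fin (2 * K + 1) => ω i) (fun z => Λ (ω K) (g z)) ∂P

/-- The smallest expected loss at the centre of a window of length `2 K + 1`. -/
def windowOpt [MeasurableSpace X] (W : Matrix X Z ℝ) (Λ : X → Y → ℝ) (P : Measure (ℕ → X)) (K : ℕ) :
    ℝ :=
  ⨅ g : (Fin (2 * K + 1) → Z) → Y, windowRisk W Λ P K g

variable [MeasurableSpace X] {W : Matrix X Z ℝ} {Λ : X → Y → ℝ} {P : Measure (ℕ → X)}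

lemma windowOpt_nonneg [Nonempty Y] (hW0 : ∀ x z, 0 ≤ W x z) (hΛ : ∀ x y, 0 ≤ Λ x y) (K : ℕ) :
    0 ≤ windowOpt W Λ P K :=
  le_ciInf fun _ => integral_nonneg fun _ => Finset.sum_nonneg fun _ _ =>
    mul_nonneg (Finset.prod_nonneg fun _ _ => hW0 _ _) (hΛ _ _)

lemma exists_windowRisk_eq [Finite Y] [Nonempty Y] (W : Matrix X Z ℝ) (Λ : X → Y → ℝ)
    (P : Measure (ℕ → X)) (K : ℕ) : ∃ g, windowRisk W Λ P K g = windowOpt W Λ P K :=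
  exists_eq_ciInf_of_finite

lemma windowOpt_le [Finite Y] (K : ℕ) (g : (Fin (2 * K + 1) → Z) → Y) :
    windowOpt W Λ P K ≤ windowRisk W Λ P K g :=
  ciInf_le (Set.finite_range _).bddBelow g

variable [Fintype X] [DiscreteMeasurableSpace X]

lemma measurable_prefix {X : Type*} [MeasurableSpace X] (n : ℕ) :
    Measurable fun (ω : ℕ → X) (i : Fin n) => ω i :=
  measurable_pi_iff.2 fun i => measurable_pi_apply (i : ℕ)

lemma integral_shift (hP : IsStationary P) {n : ℕ} (F : (Fin n → X) → ℝ) (j : ℕ) :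
    ∫ ω, F (fun i => ω (i + j)) ∂P = ∫ ω, F (fun i => ω i) ∂P := by
  have hmp := hP.2.iterate j
  have hit : ∀ (j : ℕ) (ω : ℕ → X) (i : ℕ),
      ((fun (ω : ℕ → X) (t : ℕ) => ω (t + 1))^[j] ω) i = ω (i + j) := by
    intro j
    induction j with
    | zero => intro ω i; rfl
    | succ j ih =>
      intro ω i
      rw [Function.iterate_succ_apply, ih]
      rfl
  have hmeas : Measurable fun ω : ℕ → X => F (fun i => ω i) :=
    (Measurable.of_discrete (f := F)).comp (measurable_prefix n)
  conv_rhs => rw [← hmp.map_eq]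
  rw [integral_map hmp.measurable.aemeasurable hmeas.aestronglyMeasurable]
  simp only [hit]

/-- A denoiser of a stretch of a stationary process that lies, around `t`, inside a window of
length `2 K + 1` does not beat the optimal window denoiser. -/
lemma windowOpt_le_integral [Finite Y] (hW1 : ∀ x, ∑ z, W x z = 1) (hP : IsStationary P)
    {n K : ℕ} (t : Fin n) (htK : (t : ℕ) ≤ K) (hnK : n ≤ K + 1 + t) (D : (Fin n → Z) → Y) :
    windowOpt W Λ P K ≤ ∫ ω, channelMean W (fun s : Fin n => ω s) (fun z => Λ (ω t) (D z)) ∂P := by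
  have hlt : ∀ s : Fin n, (s : ℕ) + (K - t) < 2 * K + 1 := fun s => by have := s.2; omega
  -- The translation that moves t to the centre K; stationarity absorbs it.
  let τ : Fin n → Fin (2 * K + 1) := fun s => ⟨s + (K - t), hlt s⟩
  have hτ : Function.Injective τ := fun s s' h => by
    have := congrArg Fin.val h
    simp only [τ] at this
    exact Fin.ext (by omega)
  refine (windowOpt_le K fun z => D fun s => z (τ s)).trans (le_of_eq ?_)
  rw [windowRisk, ← integral_shift hP
    (fun x : Fin n → X => channelMean W x (fun z => Λ (x t) (D z))) (K - t)]
  refine integral_congr_ae (ae_of_all _ fun ω => ?_)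
  have htK' : (t : ℕ) + (K - t) = K := by omega
  simp only [htK']
  exact channelMean_comp_injective hW1 (fun i : Fin (2 * K + 1) => ω i) hτ
    (fun z => Λ (ω K) (D z))

lemma windowOpt_antitone [Finite Y] [Nonempty Y] (hW1 : ∀ x, ∑ z, W x z = 1)
    (hP : IsStationary P) : Antitone (windowOpt W Λ P) := by
  intro K L hKL
  obtain ⟨g, hg⟩ := exists_windowRisk_eq W Λ P K
  rw [← hg]
  exact windowOpt_le_integral hW1 hP (⟨K, by omega⟩ : Fin (2 * K + 1)) hKL (by simp only; omega) g

end WindowRisk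

/-! ### Conditional risks at a single time -/

section CondRisk

variable {X Z Y : Type*} [Fintype Z] [Fintype X] [MeasurableSpace X] [DiscreteMeasurableSpace X]
  {W : Matrix X Z ℝ} {Λ : X → Y → ℝ} {M n : ℕ} {P : Fin M → Measure (ℕ → X)}

/-- Even if the switching sequence is known, no denoiser beats the optimal window denoiser. -/
lemma windowOpt_le_sum_condLaw [Finite Y] (hW0 : ∀ x z, 0 ≤ W x z) (hW1 : ∀ x, ∑ z, W x z = 1)
    (hP : ∀ i, IsStationary (P i)) (a : Fin n → Fin M) (t : Fin n) (D : (Fin n → Z) → Y) :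
    windowOpt W Λ (P (a t)) n ≤
      ∑ x, condLaw P a x * channelMean W x (fun z => Λ (x t) (D z)) := by
  classical
  have : ∀ i, IsProbabilityMeasure (P i) := fun i => (hP i).1
  rw [sum_condLaw_mul_resample P a (fun x => channelMean W x (fun z => Λ (x t) (D z)))
    (isBlockEnd_blockEnd a t), apply_blockEnd a t]
  set B : Fin n → Prop := fun s => InBlock a s (blockEnd a t)
  have hB : B t := inBlock_blockEnd a t
  -- With the clean symbols v and the outputs z' off the block frozen, D reads only the outputs
  -- inside the block. Radius n covers every position of t among n times.
  have hv : ∀ v : Fin n → X, windowOpt W Λ (P (a t)) n ≤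
      ∫ ω, channelMean W (glue B (fun s => ω s) v)
        (fun z => Λ (glue B (fun s => ω s) v t) (D z)) ∂(P (a t)) := by
    intro v
    have hgt : ∀ ω : ℕ → X, glue B (fun s => ω s) v t = ω t := fun ω => by simp [glue, hB]
    simp only [hgt, channelMean_glue hW1]
    have hint : ∀ z' : Fin n → Z, Integrable (fun ω : ℕ → X => channelMean W (fun s : Fin n => ω s)
        (fun z => Λ (ω t) (D (glue B z z')))) (P (a t)) := fun z' =>
      integrable_comp (P (a t)) (measurable_prefix n)
        (fun x => channelMean W x (fun z => Λ (x t) (D (glue B z z'))))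
    have hswap : ∫ ω : ℕ → X, channelMean W v (fun z' => channelMean W (fun s : Fin n => ω s)
        (fun z => Λ (ω t) (D (glue B z z')))) ∂(P (a t)) =
        channelMean W v (fun z' => ∫ ω : ℕ → X, channelMean W (fun s : Fin n => ω s)
          (fun z => Λ (ω t) (D (glue B z z'))) ∂(P (a t))) := by
      simp only [channelMean.eq_1 W v]
      rw [integral_finsetSum _ fun z' _ => (hint z').const_mul _]
      simp only [integral_const_mul]
    rw [hswap, ← channelMean_const hW1 v (windowOpt W Λ (P (a t)) n)]
    exact channelMean_mono hW0 v fun z' => windowOpt_le_integral hW1 (hP (a t)) t t.2.le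
      (by omega) (fun z => D (glue B z z'))
  calc windowOpt W Λ (P (a t)) n = ∑ v, condLaw P a v * windowOpt W Λ (P (a t)) n := by
        rw [← Finset.sum_mul, sum_condLaw, one_mul]
    _ ≤ _ := Finset.sum_le_sum fun v _ =>
        mul_le_mul_of_nonneg_left (hv v) (condLaw_nonneg P a v)

/-- In the interior of a block, a window denoiser performs as under the stationary law of the
block. -/
lemma sum_condLaw_window (hW1 : ∀ x, ∑ z, W x z = 1)
    (hP : ∀ i, IsStationary (P i)) (a : Fin n → Fin M) {k : ℕ} (t : Window n k)
    (ha : ∀ v : Fin n, (t.1 : ℕ) ≤ v + k → (v : ℕ) ≤ t.1 + k → a v = a t.1)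
    (g : (Fin (2 * k + 1) → Z) → Y) :
    ∑ x, condLaw P a x * channelMean W x (fun z => Λ (x t.1)
      (g fun i => z ⟨(t.1 : ℕ) - k + i, by have := t.2; have := i.2; omega⟩)) =
      windowRisk W Λ (P (a t.1)) k g := by
  classical
  have : ∀ i, IsProbabilityMeasure (P i) := fun i => (hP i).1
  obtain ⟨t, ht⟩ := t
  simp only at ha ⊢
  have hlt : ∀ i : Fin (2 * k + 1), (t : ℕ) - k + i < n := fun i => by have := i.2; omega
  let τ : Fin (2 * k + 1) → Fin n := fun i => ⟨(t : ℕ) - k + i, hlt i⟩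
  have hτ : Function.Injective τ := fun s s' h => by
    have := congrArg Fin.val h
    simp only [τ] at this
    exact Fin.ext (by omega)
  have hB : ∀ i, InBlock a (τ i) (blockEnd a t) := by
    intro i
    have hi := i.2
    refine inBlock_of_const (s := ⟨(t : ℕ) - k, by omega⟩) (u := ⟨(t : ℕ) + k, ht.2⟩)
      (Fin.le_def.2 (by simp only; omega))
      (fun v h1 h2 => ?_) (Fin.le_def.2 (by simp only; omega))
      (Fin.le_def.2 (by simp only [τ]; omega)) (Fin.le_def.2 (by simp only [τ]; omega))
    rw [Fin.le_def] at h1 h2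
    simp only at h1 h2
    exact ha v (by omega) h2
  rw [sum_condLaw_mul_resample P a (fun x => channelMean W x (fun z => Λ (x t)
    (g fun i => z ⟨(t : ℕ) - k + i, hlt i⟩))) (isBlockEnd_blockEnd a t), apply_blockEnd a t]
  have hv : ∀ v : Fin n → X, ∫ ω, channelMean W (glue (fun s => InBlock a s (blockEnd a t))
      (fun s => ω s) v) (fun z => Λ (glue (fun s => InBlock a s (blockEnd a t)) (fun s => ω s) v t)
        (g fun i => z ⟨(t : ℕ) - k + i, hlt i⟩)) ∂(P (a t)) = windowRisk W Λ (P (a t)) k g := by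
    intro v
    rw [windowRisk, ← integral_shift (hP (a t)) (fun x : Fin (2 * k + 1) → X =>
      channelMean W x (fun z => Λ (x ⟨k, by omega⟩) (g z))) (t - k)]
    refine integral_congr_ae (ae_of_all _ fun ω => ?_)
    have h1 := channelMean_comp_injective hW1 (glue (fun s => InBlock a s (blockEnd a t))
      (fun s => ω s) v) hτ (fun z => Λ (ω t) (g z))
    have h2 : glue (fun s => InBlock a s (blockEnd a t)) (fun s => ω s) v t = ω t := by
      simp [glue, inBlock_blockEnd]
    have h3 : (fun i => glue (fun s => InBlock a s (blockEnd a t)) (fun s => ω s) v (τ i)) =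
        fun i : Fin (2 * k + 1) => ω (i + (t - k)) := by
      funext i
      simp only [glue, hB i, if_true, τ]
      rw [add_comm]
    have h4 : k + ((t : ℕ) - k) = t := by omega
    simp only [h2, h4]
    rw [h3] at h1
    exact h1
  simp only [hv]
  rw [← Finset.sum_mul, sum_condLaw, one_mul]

end CondRisk

/-! ### Comparison with window denoisers that follow the switching sequence -/

section Comparison

variable {X Z Y : Type*} {M n k : ℕ}

/-- The tuple that uses, at time `t`, the window denoiser `g (a t)`. -/
def windowTuple (g : Fin M → (Fin (2 * k + 1) → Z) → Y) (a : Fin n → Fin M) (z : Fin n → Z)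
    (t : Window n k) : Z → Y :=
  fun w => g (a t.1) fun i =>
    if h : (i : ℕ) < k then (context z t).1 ⟨i, h⟩
    else if h' : (i : ℕ) = k then w
    else (context z t).2 ⟨i - (k + 1), by have := i.2; omega⟩

lemma windowTuple_apply (g : Fin M → (Fin (2 * k + 1) → Z) → Y) (a : Fin n → Fin M)
    (z : Fin n → Z) (t : Window n k) :
    windowTuple g a z t (z t.1) =
      g (a t.1) fun i => z ⟨(t.1 : ℕ) - k + i, by have := t.2; have := i.2; omega⟩ := by
  have ht := t.2
  rw [windowTuple]
  congr 1
  funext i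
  split_ifs with h h'
  · rfl
  · exact congrArg z (Fin.ext (by simp only; omega))
  · exact congrArg z (Fin.ext (by simp only; omega))

lemma exists_switch {α : Type*} (b : ℕ → α) {s t : ℕ} (hst : s ≤ t) (h : b s ≠ b t) :
    ∃ j, s ≤ j ∧ j < t ∧ b j ≠ b (j + 1) := by
  by_contra! hcon
  refine h ?_
  induction t, hst using Nat.le_induction with
  | base => rfl
  | succ t hst ih =>
    have hbt : b s = b t := by
      by_contra hne
      exact hne (ih hne fun j h1 h2 => hcon j h1 (h2.trans (Nat.lt_succ_self t)))
    rw [hbt]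
    exact hcon t hst (Nat.lt_succ_self t)

/-- Once the context is fixed, the single-symbol denoiser depends only on a t, so every shift along
a context spans a switch of `a`. -/
lemma windowTuple_mem_shiftClass (g : Fin M → (Fin (2 * k + 1) → Z) → Y) {a : Fin n → Fin M}
    {b : ℕ → Fin M} (hb : ∀ t : Fin n, b t = a t) {m : ℕ} (hm : switches n b ≤ m)
    (z : Fin n → Z) : windowTuple g a z ∈ shiftClass m z := by
  intro c
  refine le_min (numShifts_le_card _ _) (numShifts_le_of_forall_exists _ hm
    (fun t : Window n k => (t.1 : ℕ)) (fun _ _ h => h) ?_)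
  intro s t hst hne hs ht
  have hs' : context z s = c := by simpa [contextTimes] using hs
  have ht' : context z t = c := by simpa [contextTimes] using ht
  have hab : b (s.1 : ℕ) ≠ b (t.1 : ℕ) := by
    intro h
    rw [hb, hb] at h
    refine hne (funext fun w => ?_)
    simp only [windowTuple, hs', ht', h]
  have hst' : (s.1 : ℕ) < t.1 := hst
  obtain ⟨j, h1, h2, h3⟩ := exists_switch b hst'.le hab
  have := t.1.2
  exact ⟨j, Finset.mem_filter.2 ⟨Finset.mem_range.2 (by omega), h3⟩, h1, h2⟩

open Classical in
/-- Few times are close to a switch or to the ends. -/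
lemma card_near_switch_le (k : ℕ) (J : Finset ℕ) :
    (Finset.univ.filter fun t : Fin n => ¬ (k ≤ (t : ℕ) ∧ (t : ℕ) + k < n) ∨
      ∃ j ∈ J, (t : ℕ) ≤ j + k ∧ j + 1 ≤ t + k).card ≤ 2 * k + J.card * (2 * k) := by
  rw [← Finset.card_map Fin.valEmbedding]
  -- A switch sits between j and j + 1; a radius-k window contains both of these times only when its
  -- centre is one of the 2k times from j + 1 - k to j + k.
  have hsub : (Finset.univ.filter fun t : Fin n => ¬ (k ≤ (t : ℕ) ∧ (t : ℕ) + k < n) ∨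
      ∃ j ∈ J, (t : ℕ) ≤ j + k ∧ j + 1 ≤ t + k).map Fin.valEmbedding ⊆
      (Finset.range k ∪ Finset.Ico (n - k) n) ∪
        J.biUnion fun j => Finset.Icc (j + 1 - k) (j + k) := by
    intro u hu
    obtain ⟨t, ht, rfl⟩ := Finset.mem_map.1 hu
    have htn := t.2
    simp only [Finset.mem_union, Finset.mem_range, Finset.mem_Ico, Finset.mem_biUnion,
      Finset.mem_Icc, Fin.valEmbedding_apply]
    rcases (Finset.mem_filter.1 ht).2 with h | ⟨j, hj, h1, h2⟩
    · left
      omega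
    · exact Or.inr ⟨j, hj, by omega, h1⟩
  refine (Finset.card_le_card hsub).trans ((Finset.card_union_le _ _).trans (add_le_add ?_ ?_))
  · refine (Finset.card_union_le _ _).trans ?_
    rw [Finset.card_range, Nat.card_Ico]
    omega
  · refine Finset.card_biUnion_le_card_mul _ _ _ fun j _ => ?_
    rw [Nat.card_Icc]
    omega

variable [Fintype X] [Fintype Z] {W : Matrix X Z ℝ} {Λ : X → Y → ℝ}

lemma expectedLoss_eq (p : (Fin n → X) → ℝ) (D : BlockDenoiser Z Y n) :
    expectedLoss W Λ p D = 1 / (n : ℝ) *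
      ∑ t, ∑ x, p x * channelMean W x (fun z => Λ (x t) (D z t)) := by
  have h : ∀ x : Fin n → X, ∑ z : Fin n → Z, (∏ t, W (x t) (z t)) * loss Λ D x z =
      1 / (n : ℝ) * ∑ t, channelMean W x (fun z => Λ (x t) (D z t)) := by
    intro x
    rw [← channelMean_sum, ← channelMean_mul_left]
    rfl
  simp only [expectedLoss, h]
  rw [Finset.sum_comm, Finset.mul_sum]
  refine Finset.sum_congr rfl fun x _ => ?_
  rw [← Finset.mul_sum]
  ring

variable [MeasurableSpace X] [DiscreteMeasurableSpace X] {P : Fin M → Measure (ℕ → X)}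

lemma le_expectedLoss_condLaw [Finite Y] (hW0 : ∀ x z, 0 ≤ W x z) (hW1 : ∀ x, ∑ z, W x z = 1)
    (hP : ∀ i, IsStationary (P i)) (a : Fin n → Fin M) (D : BlockDenoiser Z Y n) :
    1 / (n : ℝ) * ∑ t, windowOpt W Λ (P (a t)) n ≤ expectedLoss W Λ (condLaw P a) D := by
  rw [expectedLoss_eq]
  exact mul_le_mul_of_nonneg_left (Finset.sum_le_sum fun t _ =>
    windowOpt_le_sum_condLaw hW0 hW1 hP a t fun z => D z t) (by positivity)

/-- A time whose window lies inside one block incurs exactly the optimal window risk. Every other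
time is charged C, on top of a nonnegative `windowOpt` term. -/
lemma expectedLoss_windowTuple_le [Nonempty Y] (hW0 : ∀ x z, 0 ≤ W x z)
    (hW1 : ∀ x, ∑ z, W x z = 1) (hΛ : ∀ x y, 0 ≤ Λ x y) {C : ℝ} (hC0 : 0 ≤ C)
    (hC : ∀ x y, Λ x y ≤ C)
    (hP : ∀ i, IsStationary (P i)) {g : Fin M → (Fin (2 * k + 1) → Z) → Y}
    (hg : ∀ i, windowRisk W Λ (P i) k (g i) = windowOpt W Λ (P i) k)
    {a : Fin n → Fin M} {b : ℕ → Fin M} (hb : ∀ t : Fin n, b t = a t) {m : ℕ}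
    (hm : switches n b ≤ m) (y₀ : Y) :
    expectedLoss W Λ (condLaw P a) (tupleDenoiser y₀ (windowTuple g a)) ≤
      1 / (n : ℝ) * (∑ t, windowOpt W Λ (P (a t)) k + 2 * (k + 1) * (m + 1) * C) := by
  classical
  have hPp : ∀ i, IsProbabilityMeasure (P i) := fun i => (hP i).1
  rw [expectedLoss_eq]
  refine mul_le_mul_of_nonneg_left ?_ (by positivity)
  set J := (Finset.range (n - 1)).filter fun j => b j ≠ b (j + 1) with hJ
  let bad : Fin n → Prop := fun t => ¬ (k ≤ (t : ℕ) ∧ (t : ℕ) + k < n) ∨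
      ∃ j ∈ J, (t : ℕ) ≤ j + k ∧ j + 1 ≤ t + k
  have hterm : ∀ t : Fin n, ∑ x, condLaw P a x *
      channelMean W x (fun z => Λ (x t) (tupleDenoiser y₀ (windowTuple g a) z t)) ≤
        windowOpt W Λ (P (a t)) k + if bad t then C else 0 := by
    intro t
    by_cases ht : bad t
    · rw [if_pos ht]
      have h1 : ∑ x, condLaw P a x *
          channelMean W x (fun z => Λ (x t) (tupleDenoiser y₀ (windowTuple g a) z t)) ≤
          ∑ x, condLaw P a x * C :=
        Finset.sum_le_sum fun x _ => mul_le_mul_of_nonneg_left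
          ((channelMean_mono hW0 x fun z => hC _ _).trans (channelMean_const hW1 x C).le)
          (condLaw_nonneg P a x)
      rw [← Finset.sum_mul, sum_condLaw, one_mul] at h1
      have := windowOpt_nonneg (P := P (a t)) hW0 hΛ k
      linarith
    · rw [if_neg ht, add_zero]
      obtain ⟨hwin, hsw⟩ := not_or.1 ht
      rw [not_not] at hwin
      simp only [not_exists, not_and] at hsw
      have hconst : ∀ v : Fin n, (t : ℕ) ≤ v + k → (v : ℕ) ≤ t + k → a v = a t := by
        intro v h1 h2
        rw [← hb, ← hb]
        by_contra hne
        have hvn := v.2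
        have htn := t.2
        rcases le_total (v : ℕ) t with h | h
        · obtain ⟨j, hj1, hj2, hj3⟩ := exists_switch b h hne
          exact hsw j (Finset.mem_filter.2 ⟨Finset.mem_range.2 (by omega), hj3⟩) (by omega)
            (by omega)
        · obtain ⟨j, hj1, hj2, hj3⟩ := exists_switch b h (Ne.symm hne)
          exact hsw j (Finset.mem_filter.2 ⟨Finset.mem_range.2 (by omega), hj3⟩) (by omega)
            (by omega)
      have h1 := sum_condLaw_window (Λ := Λ) hW1 hP a (k := k) ⟨t, hwin⟩ hconst (g (a t))
      rw [hg] at h1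
      refine le_of_eq (Eq.trans ?_ h1)
      refine Finset.sum_congr rfl fun x _ => ?_
      congr 2
      funext z
      rw [tupleDenoiser, dif_pos hwin, windowTuple_apply g a z ⟨t, hwin⟩]
  refine (Finset.sum_le_sum fun t _ => hterm t).trans ?_
  rw [Finset.sum_add_distrib, ← Finset.sum_filter, Finset.sum_const, nsmul_eq_mul]
  refine add_le_add le_rfl (mul_le_mul_of_nonneg_right ?_ hC0)
  have hcard : (Finset.univ.filter bad).card ≤ 2 * k + J.card * (2 * k) := by
    have := card_near_switch_le (n := n) k J
    convert this
  have hJm : J.card ≤ m := hm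
  have h2 : 2 * k + J.card * (2 * k) ≤ 2 * (k + 1) * (m + 1) := by
    have := Nat.mul_le_mul_right (2 * k) hJm
    nlinarith
  exact_mod_cast hcard.trans h2

/-- The excess loss of the shifting denoiser for a given switching sequence. -/
lemma expectedLoss_condLaw_le [DecidableEq X] [Fintype Y] (hW0 : ∀ x z, 0 ≤ W x z)
    (hW1 : ∀ x, ∑ z, W x z = 1) {H : Matrix Z X ℝ} (hH : W * H = 1) (hΛ : ∀ x y, 0 ≤ Λ x y)
    {C : ℝ} (hC0 : 0 ≤ C) (hC : ∀ x y, Λ x y ≤ C) (hP : ∀ i, IsStationary (P i)) {m : ℕ}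
    (hkn : 2 * k < n) (hm : m ≤ n - 2 * k) (y₀ : Y) {Shat : (Fin n → Z) → Window n k → Z → Y}
    (hShat : IsEstLossMinimizer W H Λ m Shat) {c r : ℝ}
    (hc : ∀ x s w, |Λ x (s w) - estLoss W H Λ w s| ≤ c) (hr : 0 < r) (hrc : r * c ≤ 1)
    {a : Fin n → Fin M} {b : ℕ → Fin M} (hb : ∀ t : Fin n, b t = a t) (hbm : switches n b ≤ m)
    (D : BlockDenoiser Z Y n) :
    expectedLoss W Λ (condLaw P a) (tupleDenoiser y₀ Shat) ≤
      expectedLoss W Λ (condLaw P a) D +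
        (2 * (r⁻¹ * ((k + 1) * (Fintype.card Z : ℝ) ^ (2 * k) *
          (Real.binEntropy ((m : ℝ) / ((n : ℝ) - 2 * k)) +
            (Real.log (Nat.card (Z → Y)) + Nat.card (Z → Y) * m) / ((n : ℝ) - 2 * k))) +
              r * c ^ 2) +
          ∑ i, (windowOpt W Λ (P i) k - windowOpt W Λ (P i) n) +
          2 * (k + 1) * (m + 1) * C / n) := by
  have : Nonempty Y := ⟨y₀⟩
  have hPp : ∀ i, IsProbabilityMeasure (P i) := fun i => (hP i).1
  choose g hg using fun i => exists_windowRisk_eq W Λ (P i) k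
  have hx := fun x => channelMean_loss_le hW0 hW1 hH hkn hm y₀ hShat
    (windowTuple_mem_shiftClass g hb hbm) hc hr hrc x
  generalize 2 * (r⁻¹ * ((k + 1) * (Fintype.card Z : ℝ) ^ (2 * k) *
          (Real.binEntropy ((m : ℝ) / ((n : ℝ) - 2 * k)) +
            (Real.log (Nat.card (Z → Y)) + Nat.card (Z → Y) * m) / ((n : ℝ) - 2 * k))) +
              r * c ^ 2) = R at hx ⊢
  have h1 : expectedLoss W Λ (condLaw P a) (tupleDenoiser y₀ Shat) ≤
      expectedLoss W Λ (condLaw P a) (tupleDenoiser y₀ (windowTuple g a)) + R := by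
    have h := Finset.sum_le_sum fun x (_ : x ∈ Finset.univ) =>
      mul_le_mul_of_nonneg_left (hx x) (condLaw_nonneg P a x)
    simp only [mul_add, Finset.sum_add_distrib] at h
    rw [← Finset.sum_mul, sum_condLaw, one_mul] at h
    exact h
  have h2 := expectedLoss_windowTuple_le hW0 hW1 hΛ hC0 hC hP hg hb hbm y₀
  have h3 := le_expectedLoss_condLaw (Λ := Λ) hW0 hW1 hP a D
  have hn0 : (0 : ℝ) < n := by exact_mod_cast (by omega : 0 < n)
  have hanti : ∀ i, 0 ≤ windowOpt W Λ (P i) k - windowOpt W Λ (P i) n := fun i =>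
    sub_nonneg.2 (windowOpt_antitone hW1 (hP i) (by omega : k ≤ n))
  -- Each gap is nonnegative, so the gap for a t is at most the sum over all M laws; this makes the
  -- bound independent of `a`.
  have h4 : 1 / (n : ℝ) * ∑ t, windowOpt W Λ (P (a t)) k ≤
      1 / (n : ℝ) * ∑ t, windowOpt W Λ (P (a t)) n +
        ∑ i, (windowOpt W Λ (P i) k - windowOpt W Λ (P i) n) := by
    rw [← sub_le_iff_le_add', ← mul_sub, ← Finset.sum_sub_distrib, one_div,
      inv_mul_le_iff₀ hn0]
    refine (Finset.sum_le_card_nsmul _ _ _ fun t _ =>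
      Finset.single_le_sum (fun i _ => hanti i) (Finset.mem_univ (a t))).trans (le_of_eq ?_)
    simp
  rw [mul_add, one_div_mul_eq_div, one_div_mul_eq_div] at h2
  rw [one_div_mul_eq_div, one_div_mul_eq_div] at h4
  rw [one_div_mul_eq_div] at h3
  linarith

end Comparison

/-! ### Consequences of the growth condition -/

section Asymptotics

variable {X Z Y : Type*} [Fintype X] [Fintype Z]

lemma spread_nonneg {ι κ : Type*} [Finite ι] [Finite κ] [Nonempty ι] [Nonempty κ]
    (f : ι → κ → ℝ) : 0 ≤ spread f := by
  have p : ι × κ := Classical.arbitrary _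
  exact sub_nonneg.2 ((ciInf_le (Set.finite_range _).bddBelow p).trans
    (le_ciSup (f := fun p : ι × κ => f p.1 p.2) (Set.finite_range _).bddAbove p))

lemma spread_pos {ι κ : Type*} [Finite ι] [Finite κ] {f : ι → κ → ℝ} {i : ι} {j j' : κ}
    (h : f i j < f i j') : 0 < spread f :=
  sub_pos.2 ((ciInf_le (f := fun p : ι × κ => f p.1 p.2)
    (Set.finite_range _).bddBelow (i, j)).trans_lt (h.trans_le
      (le_ciSup (f := fun p : ι × κ => f p.1 p.2) (Set.finite_range _).bddAbove (i, j'))))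

/-- The complexity of the shift class, relative to the length of the window. -/
def complexityRate (Z Y : Type*) [Fintype Z] (n k m : ℕ) : ℝ :=
  (k + 1) * (Fintype.card Z : ℝ) ^ (2 * k) * (Real.binEntropy ((m : ℝ) / ((n : ℝ) - 2 * k)) +
    ((m : ℝ) + 1) * Real.log (Nat.card (Z → Y)) / ((n : ℝ) - 2 * k))

lemma binEntropy_shift_nonneg {n k m : ℕ} (hkn : 2 * k < n) (hm : m ≤ n - 2 * k) :
    0 < (n : ℝ) - 2 * k ∧ 0 ≤ Real.binEntropy ((m : ℝ) / ((n : ℝ) - 2 * k)) := by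
  have h : ((n - 2 * k : ℕ) : ℝ) = (n : ℝ) - 2 * k := by
    rw [Nat.cast_sub hkn.le]; push_cast; ring
  rw [← h]
  refine ⟨by exact_mod_cast Nat.sub_pos_of_lt hkn, Real.binEntropy_nonneg (by positivity)
    (div_le_one_of_le₀ (by exact_mod_cast hm) (Nat.cast_nonneg _))⟩

/-- Once the deviation bound is below 1, its prefactor being at least 1, the exponent is negative.
The bracket is then positive, which bounds the complexity term by the ε² term. -/
lemma tendsto_complexityRate {W : Matrix X Z ℝ} {H : Matrix Z X ℝ} {Λ : X → Y → ℝ} {k m : ℕ → ℕ}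
    (hgrowth : GrowthCondition W H Λ k m) (hL : Lmax W H Λ ≠ 0) :
    Tendsto (fun n => complexityRate Z Y n (k n) (m n)) atTop (𝓝 0) := by
  rw [Metric.tendsto_nhds]
  intro ε hε
  -- With this value in place of ε, the first term of the bracket becomes 2ε / (k + 1).
  have hε' : 0 < 2 * |Lmax W H Λ| * √ε := by positivity
  filter_upwards [hgrowth.1, (hgrowth.2 _ hε').tendsto_atTop_zero.eventually_lt_const one_pos]
    with n hn hdev
  have hm : m n ≤ n - 2 * k n := hn.2.trans (Nat.div_le_self _ _)
  obtain ⟨hd, hE⟩ := binEntropy_shift_nonneg hn.1 hm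
  have hnonneg : 0 ≤ complexityRate Z Y n (k n) (m n) := by
    unfold complexityRate
    positivity
  rw [Real.dist_eq, sub_zero, abs_of_nonneg hnonneg]
  rw [deviationBound, if_neg hL] at hdev
  have hsq : (2 * |Lmax W H Λ| * √ε) ^ 2 = 4 * Lmax W H Λ ^ 2 * ε := by
    rw [mul_pow, mul_pow, sq_abs, Real.sq_sqrt hε.le]
    norm_num
  rw [hsq] at hdev
  have hk1 : (0 : ℝ) < (k n : ℝ) + 1 := by positivity
  have hfrac : 4 * Lmax W H Λ ^ 2 * ε / (2 * ((k n : ℝ) + 1) * Lmax W H Λ ^ 2) =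
      2 * ε / ((k n : ℝ) + 1) := by
    field_simp
    ring
  rw [hfrac] at hdev
  have hexp : Real.exp (-((n : ℝ) - 2 * k n) * (2 * ε / ((k n : ℝ) + 1) -
        2 * (Fintype.card Z : ℝ) ^ (2 * k n) *
          (Real.binEntropy ((m n : ℝ) / ((n : ℝ) - 2 * k n)) +
            ((m n : ℝ) + 1) * Real.log (Nat.card (Z → Y)) / ((n : ℝ) - 2 * k n)))) < 1 := by
    refine lt_of_le_of_lt ?_ hdev
    exact le_mul_of_one_le_left (Real.exp_pos _).le
      (by linarith [(Nat.cast_nonneg (k n) : (0 : ℝ) ≤ k n)])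
  rw [Real.exp_lt_one_iff, neg_mul, neg_lt_zero] at hexp
  have h1 := (pos_iff_pos_of_mul_pos hexp).1 hd
  rw [sub_pos, lt_div_iff₀ hk1] at h1
  rw [complexityRate]
  linarith

/-- The counting bound has N m where the growth condition has m log N; the exchange costs a factor
that does not depend on n. -/
lemma le_mul_complexityRate {n k m : ℕ} (hkn : 2 * k < n) (hm : m ≤ n - 2 * k)
    (hlogN : 0 < Real.log (Nat.card (Z → Y))) :
    (k + 1) * (Fintype.card Z : ℝ) ^ (2 * k) *
      (Real.binEntropy ((m : ℝ) / ((n : ℝ) - 2 * k)) +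
        (Real.log (Nat.card (Z → Y)) + Nat.card (Z → Y) * m) / ((n : ℝ) - 2 * k)) ≤
      (1 + Nat.card (Z → Y) / Real.log (Nat.card (Z → Y))) * complexityRate Z Y n k m := by
  obtain ⟨hd, hE⟩ := binEntropy_shift_nonneg hkn hm
  rw [complexityRate]
  generalize (n : ℝ) - 2 * k = d at hd hE ⊢
  generalize Real.binEntropy ((m : ℝ) / d) = E at hE ⊢
  generalize Real.log (Nat.card (Z → Y)) = L at hlogN ⊢
  have hN : (0 : ℝ) ≤ Nat.card (Z → Y) := Nat.cast_nonneg _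
  generalize (Nat.card (Z → Y) : ℝ) = N at hN ⊢
  have h1 : (1 + N / L) * (((m : ℝ) + 1) * L / d) = (m + 1) * (L + N) / d := by
    field_simp
  have h2 : (L + N * m) / d ≤ (m + 1) * (L + N) / d := by
    refine div_le_div_of_nonneg_right ?_ hd.le
    have : 0 ≤ m * L + N := by positivity
    linarith
  have h3 : E ≤ (1 + N / L) * E := le_mul_of_one_le_left hE (by linarith [div_nonneg hN hlogN.le])
  rw [mul_left_comm, mul_add (1 + N / L), h1]
  exact mul_le_mul_of_nonneg_left (add_le_add h3 h2) (by positivity)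

lemma edge_term_le_mul_complexityRate [Nonempty Z] {n k m : ℕ} (hkn : 2 * k < n)
    (hm : m ≤ n - 2 * k) (hlogN : 0 < Real.log (Nat.card (Z → Y))) {C : ℝ} (hC : 0 ≤ C) :
    2 * (k + 1) * (m + 1) * C / n ≤
      2 * C / Real.log (Nat.card (Z → Y)) * complexityRate Z Y n k m := by
  obtain ⟨hd, hE⟩ := binEntropy_shift_nonneg hkn hm
  have hdn : (n : ℝ) - 2 * k ≤ n := by linarith [(Nat.cast_nonneg k : (0 : ℝ) ≤ k)]
  have hQ : (1 : ℝ) ≤ (Fintype.card Z : ℝ) ^ (2 * k) :=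
    one_le_pow₀ (by exact_mod_cast Fintype.card_pos)
  rw [complexityRate]
  generalize (n : ℝ) - 2 * k = d at hd hE hdn ⊢
  generalize Real.binEntropy ((m : ℝ) / d) = E at hE ⊢
  generalize Real.log (Nat.card (Z → Y)) = L at hlogN ⊢
  generalize (Fintype.card Z : ℝ) ^ (2 * k) = q at hQ ⊢
  calc 2 * ((k : ℝ) + 1) * (m + 1) * C / n ≤ 2 * (k + 1) * (m + 1) * C / d :=
        div_le_div_of_nonneg_left (by positivity) hd hdn
    _ = 2 * C / L * ((k + 1) * 1 * (0 + ((m : ℝ) + 1) * L / d)) := by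
        field_simp
        ring
    _ ≤ 2 * C / L * ((k + 1) * q * (E + ((m : ℝ) + 1) * L / d)) := by
        gcongr

end Asymptotics

/-! ### Mixtures over the switching sequence -/

section Mixture

variable {X Z Y : Type*} {M n : ℕ}

lemma sum_marginal (Q : Measure (ℕ → Fin M)) [IsProbabilityMeasure Q] (n : ℕ) :
    ∑ a, marginal Q n a = 1 := by
  have := integral_comp_eq_sum Q (measurable_prefix n) (fun _ => 1)
  simpa [marginal] using this.symm

/-- Turns the almost-sure bound on the number of switches into a bound for each finite pattern of
positive mass. -/
lemma exists_of_marginal_ne_zero {Q : Measure (ℕ → Fin M)} {p : (ℕ → Fin M) → Prop}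
    (hp : ∀ᵐ b ∂Q, p b) {a : Fin n → Fin M} (ha : marginal Q n a ≠ 0) :
    ∃ b : ℕ → Fin M, (∀ t : Fin n, b t = a t) ∧ p b := by
  by_contra! hcon
  refine ha ?_
  have h0 : Q {b | ∀ t : Fin n, b t = a t} = 0 :=
    measure_mono_null (fun b hb => hcon b hb) (ae_iff.1 hp)
  rw [marginal, measureReal_def, h0, ENNReal.toReal_zero]

lemma expectedLoss_mixture [Fintype X] [Fintype Z] {α : Type*} [Fintype α] {W : Matrix X Z ℝ}
    {Λ : X → Y → ℝ} {p : (Fin n → X) → ℝ} {q : α → ℝ} {p' : α → (Fin n → X) → ℝ}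
    (h : ∀ x, p x = ∑ a, q a * p' a x) (D : BlockDenoiser Z Y n) :
    expectedLoss W Λ p D = ∑ a, q a * expectedLoss W Λ (p' a) D := by
  simp only [expectedLoss, h, Finset.sum_mul,
    Finset.mul_sum (s := (Finset.univ : Finset (Fin n → X)))]
  rw [Finset.sum_comm]
  exact Finset.sum_congr rfl fun a _ => Finset.sum_congr rfl fun x _ => mul_assoc _ _ _

lemma expectedLoss_mixture_le [Fintype X] [Fintype Z] {α : Type*} [Fintype α] {W : Matrix X Z ℝ}
    {Λ : X → Y → ℝ} {p : (Fin n → X) → ℝ} {q : α → ℝ} {p' : α → (Fin n → X) → ℝ}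
    (h : ∀ x, p x = ∑ a, q a * p' a x) (hq0 : ∀ a, 0 ≤ q a) (hq1 : ∑ a, q a = 1)
    {D D' : BlockDenoiser Z Y n} {R : ℝ}
    (hR : ∀ a, q a ≠ 0 → expectedLoss W Λ (p' a) D ≤ expectedLoss W Λ (p' a) D' + R) :
    expectedLoss W Λ p D ≤ expectedLoss W Λ p D' + R := by
  rw [expectedLoss_mixture h, expectedLoss_mixture h]
  calc ∑ a, q a * expectedLoss W Λ (p' a) D
      ≤ ∑ a, q a * (expectedLoss W Λ (p' a) D' + R) := by
        refine Finset.sum_le_sum fun a _ => ?_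
        by_cases ha : q a = 0
        · simp [ha]
        · exact mul_le_mul_of_nonneg_left (hR a ha) (hq0 a)
    _ = ∑ a, q a * expectedLoss W Λ (p' a) D' + R := by
        simp only [mul_add, Finset.sum_add_distrib]
        rw [← Finset.sum_mul, hq1, one_mul]

end Mixture

end

end SDude

/-! ### Passage to the limit -/

open SDude in
theorem theorem6 {X Z Y : Type*} [Fintype X] [DecidableEq X] [MeasurableSpace X]
    [DiscreteMeasurableSpace X] [Fintype Z] [Fintype Y]
    (W : Matrix X Z ℝ) (hW_nonneg : ∀ x z, 0 ≤ W x z) (hW_sum : ∀ x, ∑ z, W x z = 1)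
    (hW_rank : W.rank = Fintype.card X)
    (H : Matrix Z X ℝ) (hH : W * H = 1)
    (Λ : X → Y → ℝ) (hΛ : ∀ x y, 0 ≤ Λ x y)
    (k m : ℕ → ℕ) (hgrowth : SDude.GrowthCondition W H Λ k m) (hk : Tendsto k atTop atTop)
    (y₀ : Y) (Shat : ∀ n : ℕ, (Fin n → Z) → SDude.Window n (k n) → Z → Y)
    (hShat : ∀ n, SDude.IsEstLossMinimizer W H Λ (m n) (Shat n))
    (PX : Measure (ℕ → X)) (hPX : SDude.PiecewiseStationary m PX) :
    Tendsto (fun n : ℕ =>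
        SDude.expectedLoss W Λ (SDude.marginal PX n) (SDude.tupleDenoiser y₀ (Shat n)) -
          SDude.optimalLoss (Y := Y) W Λ (SDude.marginal PX n))
      atTop (𝓝 0) := by
  have hY : Nonempty Y := ⟨y₀⟩
  have hopt : ∀ n, ∃ D : BlockDenoiser Z Y n, expectedLoss W Λ (marginal PX n) D =
      optimalLoss (Y := Y) W Λ (marginal PX n) := fun n => exists_eq_ciInf_of_finite
  choose D hD using hopt
  simp only [← hD]
  -- If the loss ignores the reconstruction, all denoisers tie. Otherwise `Lmax` is positive, so the
  -- deviation bound is not the default 0, and N ≥ 2, so division by log N is meaningful.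
  by_cases hconst : ∀ x y y', Λ x y = Λ x y'
  · have h0 : ∀ n, expectedLoss W Λ (marginal PX n) (tupleDenoiser y₀ (Shat n)) -
        expectedLoss W Λ (marginal PX n) (D n) = 0 := by
      intro n
      rw [sub_eq_zero, expectedLoss_eq, expectedLoss_eq]
      simp only [hconst _ _ y₀]
    simp only [h0]
    exact tendsto_const_nhds
  push Not at hconst
  obtain ⟨x, y, y', hxy⟩ := hconst
  have hZ : Nonempty Z := by
    by_contra hcon
    rw [not_nonempty_iff] at hcon
    simpa using hW_sum x
  have hX : Nonempty X := ⟨x⟩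
  have hL : Lmax W H Λ ≠ 0 := by
    have h1 : 0 < spread Λ := by
      rcases lt_or_gt_of_ne hxy with h | h
      · exact spread_pos h
      · exact spread_pos h
    have h2 := spread_nonneg (estLoss W H Λ)
    rw [Lmax]
    linarith
  have hrate := tendsto_complexityRate hgrowth hL
  have hlogN : 0 < Real.log (Nat.card (Z → Y)) := by
    have : Nontrivial Y := ⟨y, y', fun h => hxy (by rw [h])⟩
    exact Real.log_pos (by exact_mod_cast Finite.one_lt_card)
  obtain ⟨C, hC⟩ := (Set.finite_range fun p : X × Y => Λ p.1 p.2).bddAbove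
  have hC : ∀ x y, Λ x y ≤ C := fun x y => hC ⟨(x, y), rfl⟩
  have hC0 : 0 ≤ C := (hΛ x y).trans (hC x y)
  obtain ⟨c, hc⟩ := (Set.finite_range fun p : X × (Z → Y) × Z =>
    |Λ p.1 (p.2.1 p.2.2) - estLoss W H Λ p.2.2 p.2.1|).bddAbove
  have hc : ∀ x s w, |Λ x (s w) - estLoss W H Λ w s| ≤ c := fun x s w => hc ⟨(x, s, w), rfl⟩
  have hc0 : 0 ≤ c := (abs_nonneg _).trans (hc x (fun _ => y) (Classical.arbitrary Z))
  obtain ⟨-, M, P, Q, hP, hQ, hQm, hmarg⟩ := hPX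
  have hbase : ∀ n, ∀ r, 0 < r → r * c ≤ 1 → 2 * k n < n → m n ≤ n - 2 * k n →
      expectedLoss W Λ (marginal PX n) (tupleDenoiser y₀ (Shat n)) -
        expectedLoss W Λ (marginal PX n) (D n) ≤
        2 * (r⁻¹ * ((1 + Nat.card (Z → Y) / Real.log (Nat.card (Z → Y))) *
          complexityRate Z Y n (k n) (m n)) + r * c ^ 2) +
        ∑ i, (windowOpt W Λ (P i) (k n) - windowOpt W Λ (P i) n) +
        2 * C / Real.log (Nat.card (Z → Y)) * complexityRate Z Y n (k n) (m n) := by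
    intro n r hr hrc hkn hmn
    rw [sub_le_iff_le_add']
    refine expectedLoss_mixture_le (hmarg n) (fun _ => measureReal_nonneg) (sum_marginal Q n)
      fun a ha => ?_
    obtain ⟨b, hb, hbm⟩ := exists_of_marginal_ne_zero (hQm n) ha
    refine (expectedLoss_condLaw_le hW_nonneg hW_sum hH hΛ hC0 hC hP
      hkn hmn y₀ (hShat n) hc hr hrc hb hbm (D n)).trans ?_
    have h1 := mul_le_mul_of_nonneg_left (le_mul_complexityRate hkn hmn hlogN) (inv_pos.2 hr).le
    have h2 := edge_term_le_mul_complexityRate hkn hmn hlogN hC0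
    linarith
  have hwin : Tendsto (fun n => ∑ i, (windowOpt W Λ (P i) (k n) - windowOpt W Λ (P i) n))
      atTop (𝓝 0) := by
    rw [← Finset.sum_const_zero (ι := Fin M) (s := Finset.univ)]
    refine tendsto_finsetSum _ fun i _ => ?_
    -- The radii k n and n both tend to infinity, so the two monotone limits coincide and cancel.
    have h1 := tendsto_atTop_ciInf (windowOpt_antitone (W := W) (Λ := Λ) hW_sum (hP i))
      ⟨0, by rintro _ ⟨K, rfl⟩; exact windowOpt_nonneg hW_nonneg hΛ K⟩
    have h2 := (h1.comp hk).sub h1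
    rwa [sub_self] at h2
  rw [Metric.tendsto_nhds]
  intro ε hε
  -- r is fixed before n grows: the first entry gives r c ≤ 1 for the exponential bound, the second
  -- keeps the residual 2 r c² below ε. All other terms vanish for this fixed r.
  set r : ℝ := min (1 / (c + 1)) (ε / (4 * (c ^ 2 + 1))) with hr_def
  have hr : 0 < r := by positivity
  have hrc : r * c ≤ 1 := by
    have h1 : r * (c + 1) ≤ 1 := (le_div_iff₀ (by positivity)).1 (min_le_left _ _)
    nlinarith
  have hrε : 2 * (r * c ^ 2) < ε := by
    have h1 : r * (4 * (c ^ 2 + 1)) ≤ ε := (le_div_iff₀ (by positivity)).1 (min_le_right _ _)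
    nlinarith [sq_nonneg c]
  have hlim : Tendsto (fun n => 2 * (r⁻¹ * ((1 + Nat.card (Z → Y) /
      Real.log (Nat.card (Z → Y))) * complexityRate Z Y n (k n) (m n)) + r * c ^ 2) +
        ∑ i, (windowOpt W Λ (P i) (k n) - windowOpt W Λ (P i) n) +
        2 * C / Real.log (Nat.card (Z → Y)) * complexityRate Z Y n (k n) (m n))
      atTop (𝓝 (2 * (r * c ^ 2))) := by
    have h1 := ((((hrate.const_mul (1 + Nat.card (Z → Y) /
      Real.log (Nat.card (Z → Y)))).const_mul r⁻¹).add_const (r * c ^ 2)).const_mul 2)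
    have h2 := (h1.add hwin).add (hrate.const_mul (2 * C / Real.log (Nat.card (Z → Y))))
    simpa using h2
  filter_upwards [hgrowth.1, hlim.eventually_lt_const hrε] with n hn hlt
  have hle := hbase n r hr hrc hn.1 (hn.2.trans (Nat.div_le_self _ _))
  have hge : 0 ≤ expectedLoss W Λ (marginal PX n) (tupleDenoiser y₀ (Shat n)) -
      expectedLoss W Λ (marginal PX n) (D n) := by
    rw [hD, sub_nonneg]
    exact ciInf_le (Set.finite_range _).bddBelow _
  rw [Real.dist_eq, sub_zero, abs_of_nonneg hge]
  exact hle.trans_lt hlt
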